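/- Let $k$ be a finite field with $q$ elements. For a field $K$ containing $k$ let $K[\sigma]$ be the skew polynomial ring with $\sigma x = x^q\sigma$ for $x\in K$, and let $K[t,\sigma] = k[t]\otimes_k K[\sigma]$. The field $K$ is a left $K[\sigma]$-module through $\sigma x = x^q$; the rings $K[t]$ and $K((1/t))$ are left $K[t,\sigma]$-modules, where $t$ acts by multiplication and $\sigma$ by raising all coefficients to the $q$-th power. For every field $K$ containing $k$ and every left $K[t,\sigma]$-module $M$ that is free and finitely generated both as a $K[t]$-module and as a $K[\sigma]$-module, there is an isomorphism of $k[t]$-modules $$\Phi_{K,M}\colon \operatorname{Hom}_{K[\sigma]}(M,K) \longrightarrow \operatorname{Ext}^1_{K[t,\sigma]}(M,K[t])$$ with the following properties. (1) Let $\operatorname{Res}\colon K((1/t))/K[t]\to K$ be the residue map (coefficient of $t^{-1}$). Then $\xi\mapsto \operatorname{Res}\circ\xi$ is a bijection $\operatorname{Hom}_{K[t,\sigma]}(M,K((1/t))/K[t]) \to \operatorname{Hom}_{K[\sigma]}(M,K)$, and $\Phi_{K,M}(\operatorname{Res}\circ\xi) = \partial(\xi)$ for all $\xi$, where $\partial\colon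 \operatorname{Hom}_{K[t,\sigma]}(M,K((1/t))/K[t]) \to \operatorname{Ext}^1_{K[t,\sigma]}(M,K[t])$ is the connecting map of the exact sequence $0\to K[t]\to K((1/t))\to K((1/t))/K[t]\to 0$. (2) $\Phi_{K,M}$ is natural in $M$: for every homomorphism $f\colon M\to N$ between two such modules and every $\nu\in\operatorname{Hom}_{K[\sigma]}(N,K)$ one has $\Phi_{K,M}(\nu\circ f) = f^*\Phi_{K,N}(\nu)$. (3) $\Phi_{K,M}$ is compatible with field extensions: if $K'$ is an extension field of $K$, then the $K'[t,\sigma]$-module $M_{K'} = K'\otimes_K M$, with $t(x\otimes m) = x\otimes tm$ and $\sigma(x\otimes m) = x^q\otimes\sigma m$, is again free and finitely generated both over $K'[t]$ and over $K'[\sigma]$, and for every $\mu\in\operatorname{Hom}_{K[\sigma]}(M,K)$ the map $\mu_{K'}\colon x\otimes m\mapsto x\mu(m)$ satisfies that $\Phi_{K',M_{K'}}(\mu_{K'})$ is the image of $\Phi_{K,M}(\mu)$ under the map $\operatorname{Ext}^1_{K[t,\sigma]}(M,K[t]) \to \operatorname{Ext}^1_{K'[t,\sigma]}(M_{K'},K'[t])$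 given by the exact functor $K'\otimes_K -$ and the canonical isomorphism $K'\otimes_K K[t]\cong K'[t]$. -/

import Mathlib

universe u

namespace TMotif

open CategoryTheory TensorProduct Polynomial

noncomputable section

/-! ## The rings `K[σ]` and `K[t,σ]` -/

section Rings

variable (k K : Type u) [Field k] [Finite k] [Field K] [Algebra k K]

/-- The `q`-th power Frobenius endomorphism of `K`, where `q` is the cardinality of `k`. -/
def frob : K →ₐ[k] K :=
  letI := Fintype.ofFinite k
  FiniteField.frobeniusAlgHom k K

theorem frob_apply (x : K) : frob k K x = x ^ Nat.card k := by
  let := Fintype.ofFinite k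
  simp [frob, Nat.card_eq_fintype_card]

/-- A copy of the field `K`, which will carry the action of the free monoid on one generator through
powers of the `q`-th power Frobenius, where `q` is the cardinality of `k`. -/
def Tw (_k K : Type u) : Type u := K

instance : Field (Tw k K) := inferInstanceAs (Field K)

instance : Algebra k (Tw k K) := inferInstanceAs (Algebra k K)

/-- The identity of `K`. -/
def toTw : K ≃ₐ[k] Tw k K := AlgEquiv.refl

instance : MulSemiringAction (Multiplicative ℕ) (Tw k K) :=
  MulSemiringAction.compHom (Tw k K) (powersHom (Tw k K →+* Tw k K) (frob k (Tw k K)).toRingHom)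

theorem Tw.smul_eq (n : Multiplicative ℕ) (x : Tw k K) :
    n • x = (frob k (Tw k K))^[n.toAdd] x := by
  change ((frob k (Tw k K)).toRingHom ^ n.toAdd) x = _
  rw [RingHom.coe_pow]
  rfl

instance : SMulCommClass (Multiplicative ℕ) k (Tw k K) := ⟨fun n a x => by
  rw [Tw.smul_eq, Tw.smul_eq]
  generalize n.toAdd = m
  induction m with
  | zero => rfl
  | succ m ih => simp only [Function.iterate_succ_apply', ih, map_smul]⟩

/-- The skew polynomial ring `K[σ]`, whose elements are the polynomials `∑ xᵢ σ ^ i` and whose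
multiplication is given by `σ x = x ^ q σ`, where `q` is the cardinality of `k`. -/
abbrev SkewRing : Type u := SkewPolynomial (Tw k K)

variable {K}

/-- The constants `K → K[σ]`. -/
def SkewRing.C : K →ₐ[k] SkewRing k K :=
  AlgHom.comp
    { (SkewMonoidAlgebra.singleOneRingHom : Tw k K →+* SkewRing k K) with
      commutes' := fun _ => rfl }
    (toTw k K).toAlgHom

theorem SkewRing.C_apply (x : K) :
    SkewRing.C k x = (SkewMonoidAlgebra.single 1 (toTw k K x) : SkewRing k K) := rfl

variable (K)

/-- The variable `σ` of `K[σ]`. -/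
def SkewRing.σ : SkewRing k K := SkewPolynomial.X

theorem SkewRing.σ_mul_C (x : K) :
    SkewRing.σ k K * SkewRing.C k x = SkewRing.C k (x ^ Nat.card k) * SkewRing.σ k K := by
  rw [C_apply, C_apply, σ, SkewPolynomial.X, SkewPolynomial.monomial_def, SkewMonoidAlgebra.single_mul_single,
    SkewMonoidAlgebra.single_mul_single, Tw.smul_eq]
  simp [frob_apply]

variable {K}

theorem SkewRing.single_eq (n : ℕ) (x : Tw k K) :
    SkewMonoidAlgebra.single (Multiplicative.ofAdd n) x =
      SkewRing.C k ((toTw k K).symm x) * SkewRing.σ k K ^ n := by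
  induction n generalizing x with
  | zero => rw [pow_zero, mul_one]; rfl
  | succ n ih =>
    rw [pow_succ, ← mul_assoc, ← ih, σ, SkewPolynomial.X, SkewPolynomial.monomial_def, SkewMonoidAlgebra.single_mul_single]
    simp [ofAdd_add]

/-- The universal property of `K[σ]`. -/
def SkewRing.lift {B : Type u} [Ring B] [Algebra k B] (ρ : K →ₐ[k] B) (s : B)
    (h : ∀ x, s * ρ x = ρ (x ^ Nat.card k) * s) : SkewRing k K →ₐ[k] B :=
  { SkewMonoidAlgebra.liftNCRingHom (k := Tw k K) (G := Multiplicative ℕ)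
      ((ρ.comp (toTw k K).symm.toAlgHom).toRingHom : Tw k K →+* B)
      (powersHom B s) (by
        intro x y
        rw [Tw.smul_eq]
        simp only [powersHom_apply]
        generalize y.toAdd = m
        induction m generalizing x with
        | zero => simp
        | succ m ih =>
          rw [Function.iterate_succ_apply, pow_succ, ← mul_assoc, ih, mul_assoc, mul_assoc]
          congr 1
          simp [h, frob_apply]) with
    commutes' := fun a => by
      change SkewMonoidAlgebra.liftNC _ (powersHom B s)
        (SkewMonoidAlgebra.single 1 (algebraMap k (Tw k K) a)) = _
      rw [SkewMonoidAlgebra.liftNC_single]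
      simp }

theorem SkewRing.lift_C {B : Type u} [Ring B] [Algebra k B] (ρ : K →ₐ[k] B) (s : B)
    (h : ∀ x, s * ρ x = ρ (x ^ Nat.card k) * s) (x : K) :
    SkewRing.lift k ρ s h (SkewRing.C k x) = ρ x := by
  change SkewMonoidAlgebra.liftNC _ (powersHom B s) (SkewMonoidAlgebra.single 1 (toTw k K x)) = _
  rw [SkewMonoidAlgebra.liftNC_single]
  simp

theorem SkewRing.lift_σ {B : Type u} [Ring B] [Algebra k B] (ρ : K →ₐ[k] B) (s : B)
    (h : ∀ x, s * ρ x = ρ (x ^ Nat.card k) * s) :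
    SkewRing.lift k ρ s h (SkewRing.σ k K) = s := by
  change SkewMonoidAlgebra.liftNC _ (powersHom B s)
    (SkewMonoidAlgebra.single (Multiplicative.ofAdd 1) 1) = _
  rw [SkewMonoidAlgebra.liftNC_single]
  simp

variable (K)

/-- `K[σ]` is generated by `K` and `σ`. -/
theorem SkewRing.closure_eq_top :
    Subring.closure (Set.range (SkewRing.C k (K := K)) ∪ {SkewRing.σ k K}) = ⊤ := by
  rw [eq_top_iff]
  rintro f -
  induction f using SkewMonoidAlgebra.induction_on with
  | zero => exact zero_mem _
  | add f g hf hg => exact add_mem hf hg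
  | single g a =>
    have := SkewRing.single_eq k g.toAdd a
    rw [ofAdd_toAdd] at this
    rw [this]
    have h1 : SkewRing.C k ((toTw k K).symm a) ∈
        Subring.closure (Set.range (SkewRing.C k (K := K)) ∪ {SkewRing.σ k K}) :=
      Subring.subset_closure (Or.inl ⟨_, rfl⟩)
    have h2 : SkewRing.σ k K ∈
        Subring.closure (Set.range (SkewRing.C k (K := K)) ∪ {SkewRing.σ k K}) :=
      Subring.subset_closure (Or.inr rfl)
    exact mul_mem h1 (pow_mem h2 _)

/-- The ring `K[t,σ] = k[t] ⊗ K[σ]`, the tensor product being over `k`. -/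
abbrev TSRing : Type u := k[X] ⊗[k] SkewRing k K

/-- The element `t` of `K[t,σ]`. -/
def tElt : TSRing k K := (X : k[X]) ⊗ₜ 1

/-- The inclusion `K[σ] → K[t,σ]`. -/
def ofSkew : SkewRing k K →ₐ[k] TSRing k K := Algebra.TensorProduct.includeRight

/-- The inclusion `K → K[t,σ]`. -/
def ofConst : K →+* TSRing k K := ((ofSkew k K).comp (SkewRing.C k)).toRingHom

/-- The element `σ` of `K[t,σ]`. -/
def σElt : TSRing k K := ofSkew k K (SkewRing.σ k K)

theorem tElt_comm (a : SkewRing k K) : Commute (tElt k K) (ofSkew k K a) := by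
  change (X : k[X]) ⊗ₜ[k] (1 : SkewRing k K) * 1 ⊗ₜ a = 1 ⊗ₜ a * (X : k[X]) ⊗ₜ 1
  simp

/-- The inclusion `K[t] → K[t,σ]`. -/
def ofPoly : K[X] →+* TSRing k K :=
  eval₂RingHom' (ofConst k K) (tElt k K) fun a => (tElt_comm k K (SkewRing.C k a)).symm

theorem σElt_mul_const (x : K) :
    σElt k K * ofConst k K x = ofConst k K (x ^ Nat.card k) * σElt k K := by
  change ofSkew k K _ * ofSkew k K _ = ofSkew k K _ * ofSkew k K _
  rw [← map_mul, ← map_mul]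
  exact congrArg _ (SkewRing.σ_mul_C k K x)

/-- `K[t,σ]` is generated by `K`, `t` and `σ`. -/
theorem TSRing.closure_eq_top :
    Subring.closure (Set.range (ofConst k K) ∪ ({tElt k K, σElt k K} : Set (TSRing k K))) = ⊤ := by
  set S := Subring.closure (Set.range (ofConst k K) ∪ {tElt k K, σElt k K}) with hS
  have hskew : ∀ a : SkewRing k K, ofSkew k K a ∈ S := by
    have : (⊤ : Subring (SkewRing k K)) ≤ S.comap (ofSkew k K).toRingHom := by
      rw [← SkewRing.closure_eq_top, Subring.closure_le]
      rintro _ (⟨x, rfl⟩ | rfl)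
      · exact Subring.subset_closure (Or.inl ⟨x, rfl⟩)
      · exact Subring.subset_closure (Or.inr (Or.inr rfl))
    exact fun a => this (Subring.mem_top a)
  have hpoly : ∀ p : k[X], p ⊗ₜ[k] (1 : SkewRing k K) ∈ S := by
    intro p
    induction p using Polynomial.induction_on' with
    | add p q hp hq => rw [TensorProduct.add_tmul]; exact add_mem hp hq
    | monomial n a =>
      have : (monomial n a : k[X]) ⊗ₜ[k] (1 : SkewRing k K) =
          ofSkew k K (algebraMap k _ a) * tElt k K ^ n := by
        rw [← Polynomial.smul_X_eq_monomial]
        change _ = (1 : k[X]) ⊗ₜ[k] (algebraMap k (SkewRing k K) a) * (X ⊗ₜ 1) ^ n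
        rw [Algebra.TensorProduct.tmul_pow, Algebra.TensorProduct.tmul_mul_tmul,
          TensorProduct.smul_tmul]
        simp [Algebra.algebraMap_eq_smul_one]
      rw [this]
      have h2 : tElt k K ∈ S := Subring.subset_closure (Or.inr (Or.inl rfl))
      exact mul_mem (hskew _) (pow_mem h2 _)
  rw [eq_top_iff]
  rintro f -
  induction f using TensorProduct.induction_on with
  | zero => exact zero_mem _
  | add f g hf hg => exact add_mem hf hg
  | tmul p a =>
    have : p ⊗ₜ[k] a = p ⊗ₜ[k] (1 : SkewRing k K) * ofSkew k K a := by
      change _ = _ * (1 : k[X]) ⊗ₜ[k] a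
      rw [Algebra.TensorProduct.tmul_mul_tmul]; simp
    rw [this]
    exact mul_mem (hpoly p) (hskew a)

/-- The category of left `K[t,σ]`-modules is `k[t]`-linear. -/
instance : Linear k[X] (ModuleCat.{u} (TSRing k K)) := ModuleCat.Algebra.instLinear

end Rings

/-! ## Constructing modules over `K[σ]` and `K[t,σ]` -/

section Modules

variable {k K : Type u} [Field k] [Finite k] [Field K] [Algebra k K]
variable {N : Type u} [AddCommGroup N] [Module k N] [Module K N] [IsScalarTower k K N]

/-- A Frobenius-semilinear endomorphism of a `K`-vector space is `k`-linear. -/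
def semilinToEnd (s : N →ₛₗ[(frob k K : K →+* K)] N) : Module.End k N where
  toFun := s
  map_add' := s.map_add
  map_smul' a n := by
    rw [← algebraMap_smul K a n, LinearMap.map_smulₛₗ]
    simp

/-- The action of `K[σ]` on a `K`-vector space `N` where `σ` acts through a given
Frobenius-semilinear endomorphism `s`. -/
def skewAct (s : N →ₛₗ[(frob k K : K →+* K)] N) : SkewRing k K →ₐ[k] Module.End k N :=
  SkewRing.lift k (Algebra.lsmul k k N) (semilinToEnd s) fun x => by
    ext n
    change s (x • n) = x ^ Nat.card k • s n
    rw [LinearMap.map_smulₛₗ]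
    simp [frob_apply]

theorem skewAct_C (s : N →ₛₗ[(frob k K : K →+* K)] N) (x : K) (n : N) :
    skewAct s (SkewRing.C k x) n = x • n := by
  rw [skewAct, SkewRing.lift_C]; rfl

theorem skewAct_σ (s : N →ₛₗ[(frob k K : K →+* K)] N) (n : N) :
    skewAct s (SkewRing.σ k K) n = s n := by
  rw [skewAct, SkewRing.lift_σ]; rfl

/-- The action of `K[t,σ]` on a `K`-vector space `N` where `t` acts through a given `K`-linear
endomorphism and `σ` through a given Frobenius-semilinear endomorphism commuting with it. -/
def tsAct (T : N →ₗ[K] N) (s : N →ₛₗ[(frob k K : K →+* K)] N) (h : ∀ n, T (s n) = s (T n)) :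
    TSRing k K →ₐ[k] Module.End k N :=
  Algebra.TensorProduct.lift (aeval (T.restrictScalars k)) (skewAct s) fun p a => by
    have ha : Commute (skewAct s a) (T.restrictScalars k : Module.End k N) := by
      have : (⊤ : Subring (SkewRing k K)) ≤
          (Subring.centralizer {(T.restrictScalars k : Module.End k N)}).comap
            (skewAct s).toRingHom := by
        rw [← SkewRing.closure_eq_top, Subring.closure_le]
        rintro _ (⟨x, rfl⟩ | rfl)
        · refine Subring.mem_centralizer_iff.2 ?_
          rintro _ rfl
          ext n
          change T (skewAct s (SkewRing.C k x) n) = skewAct s (SkewRing.C k x) (T n)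
          rw [skewAct_C, skewAct_C, map_smul]
        · refine Subring.mem_centralizer_iff.2 ?_
          rintro _ rfl
          ext n
          change T (skewAct s (SkewRing.σ k K) n) = skewAct s (SkewRing.σ k K) (T n)
          rw [skewAct_σ, skewAct_σ, h]
      exact (Subring.mem_centralizer_iff.1 (this (Subring.mem_top a)) _ rfl).symm
    induction p using Polynomial.induction_on' with
    | add p q hp hq => rw [map_add]; exact hp.add_left hq
    | monomial n c =>
      rw [aeval_monomial]
      have hc : Commute (algebraMap k (Module.End k N) c) (skewAct s a) := Algebra.commutes _ _
      exact hc.mul_left (ha.symm.pow_left n)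

/-- The `K[t,σ]`-module structure on a `K`-vector space `N` where `t` acts through a given
`K`-linear endomorphism and `σ` through a given Frobenius-semilinear endomorphism commuting
with it. -/
abbrev tsModule (T : N →ₗ[K] N) (s : N →ₛₗ[(frob k K : K →+* K)] N)
    (h : ∀ n, T (s n) = s (T n)) : Module (TSRing k K) N :=
  Module.compHom N (tsAct T s h).toRingHom

theorem tsModule_const (T : N →ₗ[K] N) (s : N →ₛₗ[(frob k K : K →+* K)] N)
    (h : ∀ n, T (s n) = s (T n)) (x : K) (n : N) :
    letI := tsModule T s h
    ofConst k K x • n = x • n := by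
  change tsAct T s h (Algebra.TensorProduct.includeRight (SkewRing.C k x)) n = _
  simp [tsAct, skewAct_C]

theorem tsModule_t (T : N →ₗ[K] N) (s : N →ₛₗ[(frob k K : K →+* K)] N)
    (h : ∀ n, T (s n) = s (T n)) (n : N) :
    letI := tsModule T s h
    tElt k K • n = T n := by
  change tsAct T s h ((X : k[X]) ⊗ₜ 1) n = _
  simp [tsAct]

theorem tsModule_σ (T : N →ₗ[K] N) (s : N →ₛₗ[(frob k K : K →+* K)] N)
    (h : ∀ n, T (s n) = s (T n)) (n : N) :
    letI := tsModule T s h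
    σElt k K • n = s n := by
  change tsAct T s h (Algebra.TensorProduct.includeRight (SkewRing.σ k K)) n = _
  simp [tsAct, skewAct_σ]

/-- An additive map commuting with `K`, `t` and `σ` is `K[t,σ]`-linear. -/
def mkLinear {N₁ N₂ : Type u} [AddCommGroup N₁] [AddCommGroup N₂] [Module (TSRing k K) N₁]
    [Module (TSRing k K) N₂] (f : N₁ →+ N₂)
    (hc : ∀ (x : K) n, f (ofConst k K x • n) = ofConst k K x • f n)
    (ht : ∀ n, f (tElt k K • n) = tElt k K • f n)
    (hσ : ∀ n, f (σElt k K • n) = σElt k K • f n) : N₁ →ₗ[TSRing k K] N₂ where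
  toFun := f
  map_add' := f.map_add
  map_smul' a := by
    have ha : a ∈ Subring.closure
        (Set.range (ofConst k K) ∪ ({tElt k K, σElt k K} : Set (TSRing k K))) := by
      rw [TSRing.closure_eq_top]; exact Subring.mem_top a
    simp only [RingHom.id_apply]
    induction ha using Subring.closure_induction with
    | mem a ha =>
      rcases ha with ⟨x, rfl⟩ | rfl | rfl
      · exact hc x
      · exact ht
      · exact hσ
    | zero =>
      intro n
      refine (congrArg f (zero_smul (TSRing k K) n)).trans ?_
      exact (f.map_zero).trans (zero_smul (TSRing k K) (f n)).symm
    | one =>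
      intro n
      exact (congrArg f (one_smul (TSRing k K) n)).trans (one_smul (TSRing k K) (f n)).symm
    | add a b _ _ ha hb => intro n; rw [add_smul, add_smul, map_add, ha, hb]
    | neg a _ ha => intro n; rw [neg_smul, neg_smul, map_neg, ha]
    | mul a b _ _ ha hb => intro n; rw [mul_smul, mul_smul, ha, hb]

/-- An additive map between `K[σ]`-modules that commutes with `K` and `σ` is `K[σ]`-linear. -/
def mkSkewLinear {N₁ N₂ : Type u} [AddCommGroup N₁] [AddCommGroup N₂] [Module (SkewRing k K) N₁]
    [Module (SkewRing k K) N₂] (f : N₁ →+ N₂)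
    (hc : ∀ (x : K) n, f (SkewRing.C k x • n) = SkewRing.C k x • f n)
    (hσ : ∀ n, f (SkewRing.σ k K • n) = SkewRing.σ k K • f n) : N₁ →ₗ[SkewRing k K] N₂ where
  toFun := f
  map_add' := f.map_add
  map_smul' a := by
    have ha : a ∈ Subring.closure (Set.range (SkewRing.C k (K := K)) ∪ {SkewRing.σ k K}) := by
      rw [SkewRing.closure_eq_top]; exact Subring.mem_top a
    simp only [RingHom.id_apply]
    induction ha using Subring.closure_induction with
    | mem a ha =>
      rcases ha with ⟨x, rfl⟩ | rfl
      · exact hc x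
      · exact hσ
    | zero =>
      intro n
      refine (congrArg f (zero_smul (SkewRing k K) n)).trans ?_
      exact (f.map_zero).trans (zero_smul (SkewRing k K) (f n)).symm
    | one =>
      intro n
      exact (congrArg f (one_smul (SkewRing k K) n)).trans (one_smul (SkewRing k K) (f n)).symm
    | add a b _ _ ha hb => intro n; rw [add_smul, add_smul, map_add, ha, hb]
    | neg a _ ha => intro n; rw [neg_smul, neg_smul, map_neg, ha]
    | mul a b _ _ ha hb => intro n; rw [mul_smul, mul_smul, ha, hb]

end Modules

/-! ## The modules `K`, `K[t]`, `K((1/t))` and `K((1/t))/K[t]` -/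

section Standard

variable (k K : Type u) [Field k] [Finite k] [Field K] [Algebra k K]

/-- `x ↦ x ^ q` as a semilinear endomorphism of `K`. -/
def frobSemilin : K →ₛₗ[(frob k K : K →+* K)] K where
  toFun := frob k K
  map_add' := map_add _
  map_smul' := map_mul _

/-- `K` is a left `K[σ]`-module through `σ x = x ^ q`. -/
instance : Module (SkewRing k K) K := Module.compHom K (skewAct (frobSemilin k K)).toRingHom

theorem C_smul (x y : K) : SkewRing.C k x • y = x * y := skewAct_C (frobSemilin k K) x y

theorem σ_smul (y : K) : SkewRing.σ k K • y = y ^ Nat.card k :=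
  (skewAct_σ (frobSemilin k K) y).trans (frob_apply k K y)

/-- `K[t]` is a left `K[t,σ]`-module, where `t` acts by multiplication and `σ` by the `q`-th power
Frobenius on all coefficients. -/
instance : Module (TSRing k K) K[X] :=
  tsModule (LinearMap.mulLeft K X)
    { toFun := Polynomial.map (frob k K : K →+* K)
      map_add' := fun _ _ => Polynomial.map_add _
      map_smul' := fun a p => by simp [Polynomial.smul_eq_C_mul] }
    (fun p => by simp)

/-- The field `K((1/t))` of Laurent series in the variable `1/t`: the coefficient with index `i` is
that of `(1/t) ^ i`. -/
abbrev LaurentInf (K : Type u) [Field K] : Type u := LaurentSeries K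

/-- The element `t` of `K((1/t))`. -/
def tInf : LaurentInf K := HahnSeries.single (-1) 1

/-- The endomorphism `τ` of `K((1/t))`: the `q`-th power Frobenius on all coefficients. -/
def τInf : LaurentInf K →ₛₗ[(frob k K : K →+* K)] LaurentInf K where
  toFun f := HahnSeries.map f (frob k K)
  map_add' f g := by ext; simp
  map_smul' a f := by ext; simp

theorem tInf_mul_coeff (f : LaurentInf K) (i : ℤ) : (tInf K * f).coeff i = f.coeff (i + 1) := by
  have := HahnSeries.coeff_single_mul_add (r := (1 : K)) (x := f) (a := i + 1) (b := (-1 : ℤ))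
  simpa [tInf] using this

/-- Multiplication by `t` on `K((1/t))`. -/
def tMulInf : LaurentInf K →ₗ[K] LaurentInf K where
  toFun f := tInf K * f
  map_add' := mul_add _
  map_smul' a f := by
    ext i
    change (tInf K * (a • f)).coeff i = a * (tInf K * f).coeff i
    rw [tInf_mul_coeff, tInf_mul_coeff]
    rfl

/-- `K((1/t))` is a left `K[t,σ]`-module, where `t` acts by multiplication and `σ` by the `q`-th
power Frobenius on all coefficients. -/
instance : Module (TSRing k K) (LaurentInf K) :=
  tsModule (tMulInf K) (τInf k K) (fun f => by
    ext i
    change (tInf K * τInf k K f).coeff i = frob k K ((tInf K * f).coeff i)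
    rw [tInf_mul_coeff, tInf_mul_coeff]
    rfl)

/-- The ring homomorphism `K[t] → K((1/t))`. -/
def polyToLaurentRing : K[X] →+* LaurentInf K := eval₂RingHom HahnSeries.C (tInf K)

theorem tInf_pow (n : ℕ) : tInf K ^ n = HahnSeries.single (-(n : ℤ)) 1 := by
  simp [tInf, HahnSeries.single_pow]

theorem polyToLaurentRing_coeff (p : K[X]) (i : ℤ) :
    (polyToLaurentRing K p).coeff i = if i ≤ 0 then p.coeff (-i).toNat else 0 := by
  induction p using Polynomial.induction_on' with
  | add p q hp hq => rw [map_add, HahnSeries.coeff_add, hp, hq]; split_ifs <;> simp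
  | monomial n a =>
    have h : polyToLaurentRing K (monomial n a) = HahnSeries.single (-(n : ℤ)) a := by
      simp [polyToLaurentRing, tInf_pow, HahnSeries.C_apply, HahnSeries.single_mul_single]
    rw [h, HahnSeries.coeff_single, coeff_monomial]
    have : (i ≤ 0 ∧ n = (-i).toNat) ↔ i = -(n : ℤ) := by omega
    by_cases h0 : i ≤ 0
    · by_cases h1 : i = -(n : ℤ)
      · simp [h1]
      · have h2 : ¬ n = (-i).toNat := fun h2 => h1 (this.1 ⟨h0, h2⟩)
        simp [h0, h1, h2]
    · have h1 : ¬ i = -(n : ℤ) := fun h1 => h0 (this.2 h1).1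
      simp [h0, h1]

/-- The inclusion `K[t] → K((1/t))` as a homomorphism of `K[t,σ]`-modules. -/
def polyToLaurent : K[X] →ₗ[TSRing k K] LaurentInf K :=
  mkLinear (k := k) (K := K) (polyToLaurentRing K).toAddMonoidHom
    (fun x p => by
      refine (congrArg (polyToLaurentRing K) (tsModule_const (k := k) _ _ _ x p)).trans
        (Eq.trans ?_ (tsModule_const (k := k) _ _ _ x _).symm)
      ext i
      change (polyToLaurentRing K (x • p)).coeff i = x * (polyToLaurentRing K p).coeff i
      rw [polyToLaurentRing_coeff, polyToLaurentRing_coeff]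
      split_ifs <;> simp)
    (fun p => by
      refine (congrArg (polyToLaurentRing K) (tsModule_t (k := k) _ _ _ p)).trans
        (Eq.trans ?_ (tsModule_t (k := k) _ _ _ _).symm)
      change polyToLaurentRing K (X * p) = tInf K * polyToLaurentRing K p
      simp [polyToLaurentRing])
    (fun p => by
      refine (congrArg (polyToLaurentRing K) (tsModule_σ (k := k) _ _ _ p)).trans
        (Eq.trans ?_ (tsModule_σ (k := k) _ _ _ _).symm)
      ext i
      change (polyToLaurentRing K (Polynomial.map _ p)).coeff i =
        frob k K ((polyToLaurentRing K p).coeff i)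
      rw [polyToLaurentRing_coeff, polyToLaurentRing_coeff]
      split_ifs <;> simp)

theorem polyToLaurent_apply (p : K[X]) : polyToLaurent k K p = polyToLaurentRing K p := rfl

theorem polyToLaurent_injective : Function.Injective (polyToLaurent k K) := fun p q h => by
  ext n
  have := congrArg (fun f => HahnSeries.coeff f (-(n : ℤ))) h
  simpa [polyToLaurent_apply, polyToLaurentRing_coeff] using this

/-- The `K[t,σ]`-module `K((1/t))/K[t]`. -/
abbrev PolarParts : Type u := LaurentInf K ⧸ LinearMap.range (polyToLaurent k K)

/-- The short sequence `K[t] → K((1/t)) → K((1/t))/K[t]` of `K[t,σ]`-modules. -/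
def polarSeq : ShortComplex (ModuleCat.{u} (TSRing k K)) where
  f := ModuleCat.ofHom (polyToLaurent k K)
  g := ModuleCat.ofHom (LinearMap.range (polyToLaurent k K)).mkQ
  zero := by
    ext p
    exact (Submodule.Quotient.mk_eq_zero _).2 ⟨p, rfl⟩

theorem polarSeq_shortExact : (polarSeq k K).ShortExact where
  exact := (ShortComplex.ShortExact.moduleCat_exact_iff_function_exact _).2
    (LinearMap.exact_map_mkQ_range (polyToLaurent k K))
  mono_f := (ModuleCat.mono_iff_injective _).2 (polyToLaurent_injective k K)
  epi_g := (ModuleCat.epi_iff_surjective _).2 (Submodule.mkQ_surjective _)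

/-- The residue map `K((1/t))/K[t] → K`, which sends the class of a Laurent series to its
coefficient of `1/t`. -/
def res : PolarParts k K →+ K :=
  QuotientAddGroup.lift (LinearMap.range (polyToLaurent k K)).toAddSubgroup
    (HahnSeries.coeff.addMonoidHom (1 : ℤ))
    (by
      rintro _ ⟨p, rfl⟩
      change (polyToLaurentRing K p).coeff 1 = 0
      rw [polyToLaurentRing_coeff]
      simp)

theorem res_mk (f : LaurentInf K) :
    res k K ((LinearMap.range (polyToLaurent k K)).mkQ f) = f.coeff 1 := rfl

theorem res_const (x : K) (f : PolarParts k K) : res k K (ofConst k K x • f) = x * res k K f := by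
  obtain ⟨f, rfl⟩ := Submodule.mkQ_surjective _ f
  rw [← map_smul, res_mk, res_mk]
  exact congrArg (fun g => HahnSeries.coeff g 1) (tsModule_const (k := k) _ _ _ x f)

theorem res_σ (f : PolarParts k K) : res k K (σElt k K • f) = res k K f ^ Nat.card k := by
  obtain ⟨f, rfl⟩ := Submodule.mkQ_surjective _ f
  rw [← map_smul, res_mk, res_mk, ← frob_apply]
  exact congrArg (fun g => HahnSeries.coeff g 1) (tsModule_σ (k := k) _ _ _ f)

end Standard

/-! ## The two sides of the isomorphism -/

section Sides

variable {k K : Type u} [Field k] [Finite k] [Field K] [Algebra k K]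

/-- The left `K[t,σ]`-module `M` is free and finitely generated both as a `K[t]`-module and as a
`K[σ]`-module. -/
structure IsFreeFinite (M : ModuleCat.{u} (TSRing k K)) : Prop where
  free_poly : Module.Free K[X] ((ModuleCat.restrictScalars (ofPoly k K)).obj M)
  finite_poly : Module.Finite K[X] ((ModuleCat.restrictScalars (ofPoly k K)).obj M)
  free_skew : Module.Free (SkewRing k K)
    ((ModuleCat.restrictScalars (ofSkew k K).toRingHom).obj M)
  finite_skew : Module.Finite (SkewRing k K)
    ((ModuleCat.restrictScalars (ofSkew k K).toRingHom).obj M)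

/-- The `K[t,σ]`-module `K[t]`. -/
abbrev unitModule (k K : Type u) [Field k] [Finite k] [Field K] [Algebra k K] :
    ModuleCat.{u} (TSRing k K) := ModuleCat.of (TSRing k K) K[X]

/-- The group `Hom(M, K)` of `K[σ]`-linear maps `M → K`. -/
def HomSkew (M : ModuleCat.{u} (TSRing k K)) : Type u :=
  (ModuleCat.restrictScalars (ofSkew k K).toRingHom).obj M →ₗ[SkewRing k K] K

namespace HomSkew

variable {M N : ModuleCat.{u} (TSRing k K)}

instance : AddCommGroup (HomSkew M) :=
  inferInstanceAs (AddCommGroup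
    ((ModuleCat.restrictScalars (ofSkew k K).toRingHom).obj M →ₗ[SkewRing k K] K))

/-- The underlying linear map. -/
def toLin (μ : HomSkew M) :
    (ModuleCat.restrictScalars (ofSkew k K).toRingHom).obj M →ₗ[SkewRing k K] K := μ

instance : FunLike (HomSkew M) M K where
  coe μ := fun m => toLin μ m
  coe_injective _ _ h := LinearMap.ext fun m => congrFun h m

@[ext]
theorem ext {μ ν : HomSkew M} (h : ∀ m : M, μ m = ν m) : μ = ν := DFunLike.ext _ _ h

theorem map_add (μ : HomSkew M) (m n : M) : μ (m + n) = μ m + μ n :=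
  (toLin μ).map_add m n

theorem map_skew_smul (μ : HomSkew M) (a : SkewRing k K) (m : M) :
    μ (ofSkew k K a • m) = a • μ m := (toLin μ).map_smul a m

theorem map_const_smul (μ : HomSkew M) (x : K) (m : M) : μ (ofConst k K x • m) = x * μ m :=
  (map_skew_smul μ _ m).trans (C_smul k K x _)

theorem map_σ_smul (μ : HomSkew M) (m : M) : μ (σElt k K • m) = μ m ^ Nat.card k :=
  (map_skew_smul μ _ m).trans (σ_smul k K _)

theorem add_apply (μ ν : HomSkew M) (m : M) : (μ + ν) m = μ m + ν m := rfl

/-- A `K[σ]`-linear map, given by an additive map that commutes with `K` and `σ`. -/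
def mk (f : M →+ K) (hc : ∀ (x : K) (m : M), f (ofConst k K x • m) = x * f m)
    (hσ : ∀ m : M, f (σElt k K • m) = f m ^ Nat.card k) : HomSkew M :=
  mkSkewLinear (k := k) (K := K)
    (N₁ := (ModuleCat.restrictScalars (ofSkew k K).toRingHom).obj M) f
    (fun x m => (hc x m).trans (C_smul k K x _).symm)
    (fun m => (hσ m).trans (σ_smul k K _).symm)

theorem mk_apply (f : M →+ K) (hc : ∀ (x : K) (m : M), f (ofConst k K x • m) = x * f m)
    (hσ : ∀ m : M, f (σElt k K • m) = f m ^ Nat.card k) (m : M) : mk f hc hσ m = f m := rfl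

theorem poly_smul_comm (p : k[X]) (a : SkewRing k K) (m : M) :
    (p ⊗ₜ[k] (1 : SkewRing k K) : TSRing k K) • ofSkew k K a • m =
      ofSkew k K a • (p ⊗ₜ[k] (1 : SkewRing k K) : TSRing k K) • m := by
  rw [← mul_smul, ← mul_smul]
  congr 1
  change p ⊗ₜ[k] (1 : SkewRing k K) * 1 ⊗ₜ a = 1 ⊗ₜ a * p ⊗ₜ 1
  simp

/-- `k[t]` acts on `Hom(M, K)` through its action on `M`. -/
instance : SMul k[X] (HomSkew M) where
  smul p μ :=
    { toFun := fun m => μ ((p ⊗ₜ[k] (1 : SkewRing k K) : TSRing k K) • (show M from m))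
      map_add' := fun m n => (congrArg μ (smul_add _ (show M from m) n)).trans (map_add μ _ _)
      map_smul' := fun a m => (congrArg μ (poly_smul_comm p a (show M from m))).trans
        (map_skew_smul μ a _) }

theorem smul_apply (p : k[X]) (μ : HomSkew M) (m : M) :
    (p • μ) m = μ ((p ⊗ₜ[k] (1 : SkewRing k K) : TSRing k K) • m) := rfl

instance : Module k[X] (HomSkew M) where
  one_smul μ := ext fun m => by
    rw [smul_apply]; exact congrArg μ (one_smul (TSRing k K) m)
  mul_smul p q μ := ext fun m => by
    rw [smul_apply, smul_apply, smul_apply, ← mul_smul, Algebra.TensorProduct.tmul_mul_tmul,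
      mul_one, mul_comm p q]
  smul_zero p := ext fun m => rfl
  smul_add p μ ν := ext fun m => rfl
  add_smul p q μ := ext fun m => by
    rw [add_apply, smul_apply, smul_apply, smul_apply, TensorProduct.add_tmul, add_smul, map_add]
  zero_smul μ := ext fun m => by
    rw [smul_apply, TensorProduct.zero_tmul]
    exact (congrArg μ (zero_smul (TSRing k K) m)).trans (toLin μ).map_zero

/-- Precomposition with a homomorphism of `K[t,σ]`-modules. -/
def precomp (f : M ⟶ N) (ν : HomSkew N) : HomSkew M :=
  LinearMap.comp ν ((ModuleCat.restrictScalars (ofSkew k K).toRingHom).map f).hom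

theorem precomp_apply (f : M ⟶ N) (ν : HomSkew N) (m : M) : precomp f ν m = ν (f.hom m) := rfl

/-- The map `Hom(M, K((1/t))/K[t]) → Hom(M, K)` given by composition with the residue map; on the
left homomorphisms are `K[t,σ]`-linear, on the right `K[σ]`-linear. -/
def resMap (ξ : M ⟶ ModuleCat.of (TSRing k K) (PolarParts k K)) : HomSkew M :=
  mk ((res k K).comp ξ.hom.toAddMonoidHom)
    (fun x m => (congrArg (res k K) (ξ.hom.map_smul (ofConst k K x) m)).trans (res_const k K x _))
    (fun m => (congrArg (res k K) (ξ.hom.map_smul (σElt k K) m)).trans (res_σ k K _))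

theorem resMap_apply (ξ : M ⟶ ModuleCat.of (TSRing k K) (PolarParts k K)) (m : M) :
    resMap ξ m = res k K (ξ.hom m) := rfl

end HomSkew

/-- The `k[t]`-module `Ext¹(M, K[t])` in the category of left `K[t,σ]`-modules. -/
abbrev ExtUnit (M : ModuleCat.{u} (TSRing k K)) : Type u := Abelian.Ext.{u} M (unitModule k K) 1

/-- The connecting map `Hom(M, K((1/t))/K[t]) → Ext¹(M, K[t])` of the short exact sequence
`0 → K[t] → K((1/t)) → K((1/t))/K[t] → 0`. -/
def connecting {M : ModuleCat.{u} (TSRing k K)}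
    (ξ : M ⟶ ModuleCat.of (TSRing k K) (PolarParts k K)) : ExtUnit M :=
  (Abelian.Ext.mk₀ ξ).comp (polarSeq_shortExact k K).extClass (zero_add 1)

end Sides

/-! ## Extension of the base field -/

section BaseChange

variable {k K : Type u} [Field k] [Finite k] [Field K] [Algebra k K]

/-- The `K`-vector space underlying a `K[t,σ]`-module. -/
abbrev overField (M : ModuleCat.{u} (TSRing k K)) : ModuleCat.{u} K :=
  (ModuleCat.restrictScalars (ofConst k K)).obj M

/-- The action of `t` on `M`. -/
def tEnd (M : ModuleCat.{u} (TSRing k K)) : overField M →ₗ[K] overField M where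
  toFun m := (tElt k K • (show M from m) : M)
  map_add' m n := smul_add (tElt k K) (show M from m) n
  map_smul' x m := by
    change tElt k K • ofConst k K x • (show M from m) = ofConst k K x • tElt k K • (show M from m)
    rw [← mul_smul, ← mul_smul]
    exact congrArg (· • (show M from m)) (tElt_comm k K _).eq

/-- The action of `σ` on `M`. -/
def σEnd (M : ModuleCat.{u} (TSRing k K)) :
    overField M →ₛₗ[(frob k K : K →+* K)] overField M where
  toFun m := (σElt k K • (show M from m) : M)
  map_add' m n := smul_add (σElt k K) (show M from m) n
  map_smul' x m := by
    change σElt k K • ofConst k K x • (show M from m) =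
      ofConst k K (frob k K x) • σElt k K • (show M from m)
    rw [← mul_smul, ← mul_smul, frob_apply, σElt_mul_const]

variable (K' : Type u) [Field K'] [Algebra k K'] [Algebra K K'] [IsScalarTower k K K']

/-- `x ↦ x ^ q` on `K'`, as a map that is semilinear over the Frobenius of the subfield `K`. -/
def frobOver (k K : Type u) [Field k] [Finite k] [Field K] [Algebra k K]
    (K' : Type u) [Field K'] [Algebra k K'] [Algebra K K'] [IsScalarTower k K K'] :
    K' →ₛₗ[(frob k K : K →+* K)] K' where
  toFun := frob k K'
  map_add' := _root_.map_add _
  map_smul' x y := by simp [Algebra.smul_def, frob_apply, mul_pow]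

/-- The action `x ⊗ m ↦ x ^ q ⊗ σ m` of `σ` on the base change of `M` to `K'`. -/
def σBaseChange (M : ModuleCat.{u} (TSRing k K)) :
    (K' ⊗[K] overField M) →ₛₗ[(frob k K' : K' →+* K')] (K' ⊗[K] overField M) where
  toFun := TensorProduct.map (frobOver k K K') (σEnd M)
  map_add' := _root_.map_add _
  map_smul' x z := by
    induction z using TensorProduct.induction_on with
    | zero => simp
    | add z w hz hw => rw [smul_add, _root_.map_add, _root_.map_add, smul_add, hz, hw]
    | tmul y m =>
      rw [TensorProduct.smul_tmul', TensorProduct.map_tmul, TensorProduct.map_tmul,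
        TensorProduct.smul_tmul']
      congr 1
      exact _root_.map_mul (frob k K') x y

theorem σBaseChange_tmul (M : ModuleCat.{u} (TSRing k K)) (x : K') (m : overField M) :
    σBaseChange K' M (x ⊗ₜ m) = (x ^ Nat.card k) ⊗ₜ σEnd M m := by
  rw [← frob_apply]; rfl

/-- The base change of `M` to `K'`, with underlying `K'`-vector space the tensor product of `K'` and
`M` over `K`; here `t` acts through `x ⊗ m ↦ x ⊗ t m` and `σ` through `x ⊗ m ↦ x ^ q ⊗ σ m`. -/
instance (M : ModuleCat.{u} (TSRing k K)) : Module (TSRing k K') (K' ⊗[K] overField M) :=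
  tsModule ((tEnd M).baseChange K') (σBaseChange K' M) (fun z => by
    induction z using TensorProduct.induction_on with
    | zero => simp
    | add z w hz hw => simp only [_root_.map_add, hz, hw]
    | tmul y m =>
      rw [σBaseChange_tmul, LinearMap.baseChange_tmul, LinearMap.baseChange_tmul, σBaseChange_tmul]
      congr 1
      change tElt k K • σElt k K • (show M from m) = σElt k K • tElt k K • (show M from m)
      rw [← mul_smul, ← mul_smul]
      exact congrArg (· • (show M from m)) (tElt_comm k K _).eq)

theorem baseChange_const_smul (M : ModuleCat.{u} (TSRing k K)) (x : K') (z : K' ⊗[K] overField M) :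
    ofConst k K' x • z = x • z := tsModule_const (k := k) _ _ _ x z

theorem baseChange_t_smul (M : ModuleCat.{u} (TSRing k K)) (z : K' ⊗[K] overField M) :
    tElt k K' • z = (tEnd M).baseChange K' z := tsModule_t (k := k) _ _ _ z

theorem baseChange_σ_smul (M : ModuleCat.{u} (TSRing k K)) (z : K' ⊗[K] overField M) :
    σElt k K' • z = σBaseChange K' M z := tsModule_σ (k := k) _ _ _ z

/-- The underlying `K`-linear map of a homomorphism of `K[t,σ]`-modules. -/
abbrev overFieldMap {M N : ModuleCat.{u} (TSRing k K)} (f : M ⟶ N) :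
    overField M →ₗ[K] overField N := ((ModuleCat.restrictScalars (ofConst k K)).map f).hom

/-- The homomorphism `x ⊗ m ↦ x ⊗ f m` between base changes. -/
def baseChangeMap {M N : ModuleCat.{u} (TSRing k K)} (f : M ⟶ N) :
    (K' ⊗[K] overField M) →ₗ[TSRing k K'] (K' ⊗[K] overField N) :=
  mkLinear ((overFieldMap f).baseChange K').toAddMonoidHom
    (fun x z => by
      rw [baseChange_const_smul, baseChange_const_smul]
      exact map_smul ((overFieldMap f).baseChange K') x z)
    (fun z => by
      rw [baseChange_t_smul, baseChange_t_smul]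
      change (overFieldMap f).baseChange K' _ = (tEnd N).baseChange K' ((overFieldMap f).baseChange K' z)
      induction z using TensorProduct.induction_on with
      | zero => simp
      | add z w hz hw => simp only [_root_.map_add, hz, hw]
      | tmul y m =>
        rw [LinearMap.baseChange_tmul, LinearMap.baseChange_tmul, LinearMap.baseChange_tmul,
          LinearMap.baseChange_tmul]
        congr 1
        exact f.hom.map_smul (tElt k K) m)
    (fun z => by
      rw [baseChange_σ_smul, baseChange_σ_smul]
      change (overFieldMap f).baseChange K' _ = σBaseChange K' N ((overFieldMap f).baseChange K' z)
      induction z using TensorProduct.induction_on with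
      | zero => simp
      | add z w hz hw => simp only [_root_.map_add, hz, hw]
      | tmul y m =>
        rw [σBaseChange_tmul, LinearMap.baseChange_tmul, LinearMap.baseChange_tmul,
          σBaseChange_tmul]
        congr 1
        exact f.hom.map_smul (σElt k K) m)

theorem baseChangeMap_apply {M N : ModuleCat.{u} (TSRing k K)} (f : M ⟶ N)
    (z : K' ⊗[K] overField M) : baseChangeMap K' f z = (overFieldMap f).baseChange K' z := rfl

/-- The base change functor from `K[t,σ]`-modules to `K'[t,σ]`-modules. -/
def baseChange (k K K' : Type u) [Field k] [Finite k] [Field K] [Algebra k K] [Field K']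
    [Algebra k K'] [Algebra K K'] [IsScalarTower k K K'] :
    ModuleCat.{u} (TSRing k K) ⥤ ModuleCat.{u} (TSRing k K') where
  obj M := ModuleCat.of (TSRing k K') (K' ⊗[K] overField M)
  map f := ModuleCat.ofHom (baseChangeMap K' f)
  map_id M := by
    ext z
    change (overFieldMap (𝟙 M)).baseChange K' z = z
    induction z using TensorProduct.induction_on with
    | zero => simp
    | add z w hz hw => rw [_root_.map_add, hz, hw]
    | tmul y m => rfl
  map_comp {L M N} f g := by
    ext z
    change (overFieldMap (f ≫ g)).baseChange K' z =
      (overFieldMap g).baseChange K' ((overFieldMap f).baseChange K' z)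
    induction z using TensorProduct.induction_on with
    | zero => simp
    | add z w hz hw => rw [_root_.map_add, hz, hw, _root_.map_add, _root_.map_add]
    | tmul y m => rfl

instance : (baseChange k K K').Additive where
  map_add {M N f g} := by
    ext z
    change (overFieldMap (f + g)).baseChange K' z =
      (overFieldMap f).baseChange K' z + (overFieldMap g).baseChange K' z
    induction z using TensorProduct.induction_on with
    | zero => simp
    | add z w hz hw => rw [_root_.map_add, hz, hw, _root_.map_add, _root_.map_add]; abel
    | tmul y m => exact TensorProduct.tmul_add y _ _

theorem baseChange_shortExact (S : ShortComplex (ModuleCat.{u} (TSRing k K)))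
    (hS : S.ShortExact) : (S.map (baseChange k K K')).ShortExact where
  exact := by
    rw [ShortComplex.ShortExact.moduleCat_exact_iff_function_exact]
    exact Module.Flat.lTensor_exact (R := K) K'
      (f := overFieldMap S.f) (g := overFieldMap S.g)
      ((ShortComplex.ShortExact.moduleCat_exact_iff_function_exact S).1 hS.exact)
  mono_f := (ModuleCat.mono_iff_injective _).2
    (Module.Flat.lTensor_preserves_injective_linearMap (M := K') (overFieldMap S.f)
      hS.moduleCat_injective_f)
  epi_g := (ModuleCat.epi_iff_surjective _).2
    (LinearMap.lTensor_surjective K' (g := overFieldMap S.g) hS.moduleCat_surjective_g)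

theorem baseChange_exact : Limits.PreservesFiniteLimits (baseChange k K K') ∧
    Limits.PreservesFiniteColimits (baseChange k K K') :=
  ((Functor.exact_tfae (baseChange k K K')).out 0 3 rfl rfl).1 (baseChange_shortExact K')

instance : Limits.PreservesFiniteLimits (baseChange k K K') := (baseChange_exact K').1

instance : Limits.PreservesFiniteColimits (baseChange k K K') := (baseChange_exact K').2

/-- The `K'[σ]`-linear map `x ⊗ m ↦ x μ(m)` induced by `μ`. -/
def HomSkew.baseChange {M : ModuleCat.{u} (TSRing k K)} (μ : HomSkew M) :
    HomSkew ((TMotif.baseChange k K K').obj M) :=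
  let g : overField M →ₗ[K] K' :=
    { toFun := fun m => algebraMap K K' (μ (show M from m))
      map_add' := fun m n => by rw [← _root_.map_add]; exact congrArg _ (μ.map_add m n)
      map_smul' := fun x m => by
        rw [RingHom.id_apply, Algebra.smul_def, ← _root_.map_mul]
        exact congrArg _ (μ.map_const_smul x m) }
  HomSkew.mk (M := (TMotif.baseChange k K K').obj M) (g.liftBaseChange K').toAddMonoidHom
    (fun x z => by
      refine (congrArg (g.liftBaseChange K') (baseChange_const_smul K' M x z)).trans ?_
      exact (g.liftBaseChange K').map_smul x (show K' ⊗[K] overField M from z))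
    (fun z => by
      refine (congrArg (g.liftBaseChange K') (baseChange_σ_smul K' M z)).trans ?_
      change _ = (g.liftBaseChange K' z) ^ Nat.card k
      rw [← frob_apply k K']
      induction z using TensorProduct.induction_on with
      | zero => simp
      | add z w hz hw => rw [_root_.map_add, _root_.map_add, _root_.map_add, _root_.map_add, hz, hw]
      | tmul y m =>
        rw [σBaseChange_tmul, LinearMap.liftBaseChange_tmul, LinearMap.liftBaseChange_tmul,
          smul_eq_mul, smul_eq_mul, frob_apply, mul_pow]
        congr 1
        change algebraMap K K' (μ (σElt k K • (show M from m))) = algebraMap K K' (μ _) ^ _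
        rw [μ.map_σ_smul, map_pow])

theorem HomSkew.baseChange_tmul {M : ModuleCat.{u} (TSRing k K)} (μ : HomSkew M) (x : K')
    (m : overField M) :
    HomSkew.baseChange K' μ (x ⊗ₜ[K] m : K' ⊗[K] overField M) =
      x * algebraMap K K' (μ (show M from m)) := rfl

/-- The map `K[t] → K'[t]` as a `K`-linear map. -/
def unitBaseChangeAux (k K K' : Type u) [Field k] [Finite k] [Field K] [Algebra k K] [Field K']
    [Algebra k K'] [Algebra K K'] [IsScalarTower k K K'] :
    overField (unitModule k K) →ₗ[K] K'[X] where
  toFun p := Polynomial.map (algebraMap K K') (show K[X] from p)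
  map_add' p q := Polynomial.map_add _
  map_smul' x p := by
    have h : (ofConst k K x • (show K[X] from p) : K[X]) = x • (show K[X] from p) :=
      tsModule_const (k := k) _ _ _ x _
    have key : ∀ r : K[X], Polynomial.map (algebraMap K K') (x • r) =
        x • Polynomial.map (algebraMap K K') r := fun r => by
      ext i
      simp [Algebra.smul_def]
    exact (congrArg (Polynomial.map (algebraMap K K')) h).trans (key _)

/-- The homomorphism `x ⊗ p ↦ x p` from the base change of `K[t]` to `K'[t]`. -/
def unitBaseChange (k K K' : Type u) [Field k] [Finite k] [Field K] [Algebra k K] [Field K']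
    [Algebra k K'] [Algebra K K'] [IsScalarTower k K K'] :
    (baseChange k K K').obj (unitModule k K) ⟶ unitModule k K' :=
  ModuleCat.ofHom (X := K' ⊗[K] overField (unitModule k K)) (mkLinear
    ((unitBaseChangeAux k K K').liftBaseChange K').toAddMonoidHom
    (fun x z => by
      rw [baseChange_const_smul]
      refine Eq.trans ?_ (tsModule_const (k := k) _ _ _ x _).symm
      exact map_smul ((unitBaseChangeAux k K K').liftBaseChange K') x z)
    (fun z => by
      rw [baseChange_t_smul]
      refine Eq.trans ?_ (tsModule_t (k := k) _ _ _ _).symm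
      change (unitBaseChangeAux k K K').liftBaseChange K' _ =
        X * (unitBaseChangeAux k K K').liftBaseChange K' z
      induction z using TensorProduct.induction_on with
      | zero => simp
      | add z w hz hw => rw [_root_.map_add, _root_.map_add, _root_.map_add, mul_add, hz, hw]
      | tmul y p =>
        have h : (tElt k K • (show K[X] from p) : K[X]) = X * (show K[X] from p) :=
          tsModule_t (k := k) _ _ _ _
        rw [LinearMap.baseChange_tmul, LinearMap.liftBaseChange_tmul,
          LinearMap.liftBaseChange_tmul, mul_smul_comm]
        congr 1
        refine (congrArg (Polynomial.map (algebraMap K K')) h).trans ?_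
        rw [Polynomial.map_mul, Polynomial.map_X]
        rfl)
    (fun z => by
      rw [baseChange_σ_smul]
      refine Eq.trans ?_ (tsModule_σ (k := k) _ _ _ _).symm
      change (unitBaseChangeAux k K K').liftBaseChange K' _ =
        Polynomial.map (frob k K' : K' →+* K') ((unitBaseChangeAux k K K').liftBaseChange K' z)
      induction z using TensorProduct.induction_on with
      | zero => simp
      | add z w hz hw =>
        rw [_root_.map_add, _root_.map_add, _root_.map_add, Polynomial.map_add, hz, hw]
      | tmul y p =>
        have h : (σElt k K • (show K[X] from p) : K[X]) =
            Polynomial.map (frob k K : K →+* K) (show K[X] from p) :=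
          tsModule_σ (k := k) _ _ _ _
        rw [σBaseChange_tmul, LinearMap.liftBaseChange_tmul, LinearMap.liftBaseChange_tmul]
        have h' : unitBaseChangeAux k K K' (σEnd (unitModule k K) p) =
            Polynomial.map (frob k K' : K' →+* K') (unitBaseChangeAux k K K' p) := by
          have key : ∀ r : K[X], Polynomial.map (algebraMap K K')
              (Polynomial.map (frob k K : K →+* K) r) =
              Polynomial.map (frob k K' : K' →+* K') (Polynomial.map (algebraMap K K') r) :=
            fun r => by
              ext i
              simp [frob_apply]
          exact (congrArg (Polynomial.map (algebraMap K K')) h).trans (key _)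
        rw [h']
        ext i
        simp [frob_apply]))

theorem unitBaseChange_tmul (x : K') (p : overField (unitModule k K)) :
    (unitBaseChange k K K').hom (x ⊗ₜ[K] p : K' ⊗[K] overField (unitModule k K)) =
      x • Polynomial.map (algebraMap K K') (show K[X] from p) := rfl

/-- The map `Ext¹(M, K[t]) → Ext¹(M', K'[t])` given by base change to `K'`. -/
def extBaseChange {M : ModuleCat.{u} (TSRing k K)} (e : ExtUnit M) :
    ExtUnit ((baseChange k K K').obj M) :=
  (e.mapExactFunctor (baseChange k K K')).comp (Abelian.Ext.mk₀ (unitBaseChange k K K'))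
    (add_zero 1)

end BaseChange

end

end TMotif

namespace TMotif

open CategoryTheory TensorProduct Polynomial

noncomputable section

/-! ### Residues and the universal property of $K((1/t))/K[t]$. -/

section Laurent

variable {k K : Type u} [Field k] [Finite k] [Field K] [Algebra k K]

/-! The isomorphism is $\partial\circ(\operatorname{Res}\circ -)^{-1}$, so both maps have to be
bijective.

The residue map is bijective for every $K[t,\sigma]$-module $M$, because $K((1/t))/K[t]$ is
coinduced from the $K[\sigma]$-module $K$: a principal part is an arbitrary sequence of coefficients
$\operatorname{Res}(t^n x)$, $n\ge 0$ (`polarParts_ext`), and the inverse sends $\mu$ to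
$m\mapsto\sum_{n\ge 0}\mu(t^n m)t^{-n-1}$.

The long exact sequence makes $\partial$ bijective once $\operatorname{Hom}(M,K((1/t)))$ and
$\operatorname{Ext}^1(M,K((1/t)))$ vanish. Both follow from one boundedness statement
(`exists_bound`): constants and $\sigma$ act coefficientwise on $K((1/t))$, so a $K[\sigma]$-linear
map from a finitely generated module has values of bounded degree in $t$. If the map also commutes
with $t$, which raises the degree, it must be zero (`hom_laurent_eq_zero`). For
$\operatorname{Ext}^1$, a lifting problem with kernel $K((1/t))$ is solved over $K[\sigma]$ by
projectivity; the failure of the lift to commute with $t$ is a $K[\sigma]$-linear map $\delta\colon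
M\to K((1/t))$, and the lift can be corrected by any $g$ with $gt-tg=\delta$. The series
$g(m)=-\sum_{n\ge 0}t^{-n-1}\delta(t^n m)$ is such a $g$, and it converges because $\delta$ is
bounded (`exists_commutator_eq`, `exists_lift`).

Naturality in $M$ is associativity of the Yoneda product, since $\partial$ is multiplication by a
fixed class. For field extensions the polar sequence over $K$, tensored with $K'$, maps to the one
over $K'$, and extension classes are natural for such morphisms. Freeness of $M_{K'}$ comes from
comparing bases (`free_and_finite_baseChange`). -/

theorem laurent_const_coeff (x : K) (f : LaurentInf K) (i : ℤ) :
    (ofConst k K x • f).coeff i = x * f.coeff i :=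
  congrArg (fun g => HahnSeries.coeff g i) (tsModule_const (k := k) _ _ _ x f)

theorem laurent_t_coeff (f : LaurentInf K) (i : ℤ) :
    (tElt k K • f).coeff i = f.coeff (i + 1) :=
  (congrArg (fun g => HahnSeries.coeff g i) (tsModule_t (k := k) _ _ _ f)).trans
    (tInf_mul_coeff K f i)

theorem laurent_σ_coeff (f : LaurentInf K) (i : ℤ) :
    (σElt k K • f).coeff i = f.coeff i ^ Nat.card k :=
  (congrArg (fun g => HahnSeries.coeff g i) (tsModule_σ (k := k) _ _ _ f)).trans
    (frob_apply k K _)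

theorem laurent_t_pow_coeff (n : ℕ) (f : LaurentInf K) (i : ℤ) :
    ((tElt k K) ^ n • f).coeff i = f.coeff (i + n) := by
  induction n generalizing i with
  | zero => rw [pow_zero, one_smul]; simp
  | succ n ih =>
    rw [pow_succ', mul_smul, laurent_t_coeff, ih]
    congr 1
    push_cast
    ring

/-- The Laurent series with given coefficients, which vanish below a given index. -/
def laurentOfCoeff (a : ℤ → K) (N : ℤ) (h : ∀ i < N, a i = 0) : LaurentInf K :=
  HahnSeries.ofSuppBddBelow a ⟨N, fun i hi => by
    by_contra hlt
    exact hi (h i (not_le.1 hlt))⟩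

theorem laurentOfCoeff_coeff (a : ℤ → K) (N : ℤ) (h : ∀ i < N, a i = 0) (i : ℤ) :
    (laurentOfCoeff a N h).coeff i = a i := rfl

/-- Multiplying by $t^n$ moves the coefficient of $t^{-n-1}$ into residue position, so these
residues recover the whole principal part. -/
theorem res_t_pow (n : ℕ) (f : LaurentInf K) :
    res k K ((tElt k K) ^ n • (LinearMap.range (polyToLaurent k K)).mkQ f) =
      f.coeff (1 + n) := by
  rw [← map_smul, res_mk, laurent_t_pow_coeff]

/-- A class in `K((1/t))/K[t]` is determined by the residues of its multiples by powers of `t`. -/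
theorem polarParts_ext {x y : PolarParts k K}
    (h : ∀ n : ℕ, res k K ((tElt k K) ^ n • x) = res k K ((tElt k K) ^ n • y)) : x = y := by
  obtain ⟨f, rfl⟩ := Submodule.mkQ_surjective _ x
  obtain ⟨g, rfl⟩ := Submodule.mkQ_surjective _ y
  simp only [res_t_pow] at h
  refine (Submodule.Quotient.eq _).2 ?_
  have hpos : ∀ i : ℤ, 0 < i → (f - g).coeff i = 0 := fun i hi => by
    have := h (i - 1).toNat
    rw [show (1 : ℤ) + ((i - 1).toNat : ℤ) = i by omega] at this
    rw [HahnSeries.coeff_sub, this, sub_self]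
  -- With no coefficients at positive indices, $f-g$ involves only powers $t^n$ with $n\ge 0$, and
  -- finitely many of them because its order is finite. It is therefore a polynomial.
  have hfin : (Function.support fun n : ℕ => (f - g).coeff (-(n : ℤ))).Finite := by
    by_cases h0 : f - g = 0
    · simp [h0]
    · refine (Set.finite_Iic (-(f - g).order).toNat).subset fun n hn => ?_
      have := HahnSeries.order_le_of_coeff_ne_zero hn
      simp only [Set.mem_Iic]
      omega
  refine ⟨∑ n ∈ hfin.toFinset, monomial n ((f - g).coeff (-(n : ℤ))), ?_⟩
  ext i
  rw [polyToLaurent_apply, polyToLaurentRing_coeff]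
  split_ifs with hi
  · have hi' : -((-i).toNat : ℤ) = i := by omega
    simp only [finsetSum_coeff, coeff_monomial, Finset.sum_ite_eq', hi']
    refine ite_eq_left_iff.2 fun hn => ?_
    by_contra h0
    refine hn (hfin.mem_toFinset.2 ?_)
    rw [Function.mem_support, hi']
    exact Ne.symm h0
  · exact (hpos i (not_le.1 hi)).symm

/-- Linearity in $t$ gives $\operatorname{Res}(t^n\xi(m))=\operatorname{Res}(\xi(t^n m))$, so
$\operatorname{Res}\circ\xi$ determines every principal part $\xi(m)$. -/
theorem HomSkew.resMap_injective {M : ModuleCat.{u} (TSRing k K)} :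
    Function.Injective
      (HomSkew.resMap : (M ⟶ ModuleCat.of (TSRing k K) (PolarParts k K)) → HomSkew M) := by
  intro ξ η h
  ext m
  refine polarParts_ext fun n => ?_
  have := DFunLike.congr_fun h ((tElt k K) ^ n • m)
  rw [HomSkew.resMap_apply, HomSkew.resMap_apply, ξ.hom.map_smul, η.hom.map_smul] at this
  exact this

theorem tElt_pow_comm_const (n : ℕ) (x : K) :
    (tElt k K) ^ n * ofConst k K x = ofConst k K x * (tElt k K) ^ n :=
  ((tElt_comm k K (SkewRing.C k x)).pow_left n).eq

theorem tElt_pow_comm_σ (n : ℕ) : (tElt k K) ^ n * σElt k K = σElt k K * (tElt k K) ^ n :=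
  ((tElt_comm k K (SkewRing.σ k K)).pow_left n).eq

/-- The generating series `∑ μ (tⁿ m) t⁻ⁿ⁻¹` of a `K[σ]`-linear map `μ`. -/
def HomSkew.series {M : ModuleCat.{u} (TSRing k K)} (μ : HomSkew M) (m : M) : LaurentInf K :=
  laurentOfCoeff (fun i => if 1 ≤ i then μ ((tElt k K) ^ (i - 1).toNat • m) else 0) 1
    fun _ hi => if_neg (not_le.2 hi)

theorem HomSkew.res_t_pow_series {M : ModuleCat.{u} (TSRing k K)} (μ : HomSkew M) (m : M)
    (n : ℕ) :
    res k K ((tElt k K) ^ n • (LinearMap.range (polyToLaurent k K)).mkQ (μ.series m)) =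
      μ ((tElt k K) ^ n • m) := by
  rw [res_t_pow, HomSkew.series, laurentOfCoeff_coeff, if_pos (by omega)]
  congr 3
  omega

/-- The preimage of $\mu$ is the class of its generating series. Each linearity property is tested
on the residues of $t^n$-multiples, where it becomes a property of $\mu$, because $t^n$ commutes
with constants and with $\sigma$. -/
theorem HomSkew.resMap_surjective {M : ModuleCat.{u} (TSRing k K)} :
    Function.Surjective
      (HomSkew.resMap : (M ⟶ ModuleCat.of (TSRing k K) (PolarParts k K)) → HomSkew M) := by
  intro μ
  let F : M → PolarParts k K := fun m => (LinearMap.range (polyToLaurent k K)).mkQ (μ.series m)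
  have hF (m : M) (n : ℕ) : res k K ((tElt k K) ^ n • F m) = μ ((tElt k K) ^ n • m) :=
    μ.res_t_pow_series m n
  let G : M →+ PolarParts k K :=
    { toFun := F
      map_zero' := polarParts_ext fun n => by
        rw [hF, smul_zero, smul_zero, (res k K).map_zero]
        exact (HomSkew.toLin μ).map_zero
      map_add' := fun a b => polarParts_ext fun n => by
        rw [hF, smul_add, HomSkew.map_add, smul_add, _root_.map_add, hF, hF] }
  have hG (m : M) (n : ℕ) : res k K ((tElt k K) ^ n • G m) = μ ((tElt k K) ^ n • m) := hF m n
  refine ⟨ModuleCat.ofHom (mkLinear G ?_ ?_ ?_), ?_⟩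
  · refine fun x m => polarParts_ext fun n => ?_
    rw [hG, ← mul_smul, ← mul_smul, tElt_pow_comm_const, mul_smul, mul_smul, res_const, hG,
      HomSkew.map_const_smul]
  · refine fun m => polarParts_ext fun n => ?_
    rw [hG, ← mul_smul, ← mul_smul, ← pow_succ, hG]
  · refine fun m => polarParts_ext fun n => ?_
    rw [hG, ← mul_smul, ← mul_smul, tElt_pow_comm_σ, mul_smul, mul_smul, res_σ, hG,
      HomSkew.map_σ_smul]
  · ext m
    have := hG m 0
    rw [pow_zero, one_smul, one_smul] at this
    exact this

end Laurent

/-! ### Vanishing of $\operatorname{Hom}$ and $\operatorname{Ext}^1$ into $K((1/t))$. -/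

section Splitting

variable {k K : Type u} [Field k] [Finite k] [Field K] [Algebra k K]

/-- The `K[σ]`-module underlying a `K[t,σ]`-module. -/
abbrev overSkew (M : ModuleCat.{u} (TSRing k K)) : ModuleCat.{u} (SkewRing k K) :=
  (ModuleCat.restrictScalars (ofSkew k K).toRingHom).obj M

/-- The Laurent series whose coefficients vanish below a given index are stable under `K[σ]`. -/
theorem coeff_smul_eq_zero (N : ℤ) (a : SkewRing k K) :
    ∀ f : LaurentInf K, (∀ i < N, f.coeff i = 0) → ∀ i < N, (ofSkew k K a • f).coeff i = 0 := by
  have ha : a ∈ Subring.closure (Set.range (SkewRing.C k (K := K)) ∪ {SkewRing.σ k K}) := by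
    rw [SkewRing.closure_eq_top]; exact Subring.mem_top a
  induction ha using Subring.closure_induction with
  -- Both kinds of generators act coefficientwise and send a zero coefficient to zero; for $\sigma$
  -- this is $0^q=0$ with $q>0$.
  | mem a ha =>
    rcases ha with ⟨x, rfl⟩ | rfl
    · intro f hf i hi
      refine (laurent_const_coeff x f i).trans ?_
      rw [hf i hi, mul_zero]
    · intro f hf i hi
      refine (laurent_σ_coeff (k := k) f i).trans ?_
      rw [hf i hi, zero_pow Nat.card_pos.ne']
  | zero =>
    intro f hf i hi
    rw [_root_.map_zero]
    exact congrArg (fun g => HahnSeries.coeff g i) (zero_smul (TSRing k K) f)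
  | one =>
    intro f hf i hi
    rw [_root_.map_one]
    exact (congrArg (fun g => HahnSeries.coeff g i) (one_smul (TSRing k K) f)).trans (hf i hi)
  | add a b _ _ ha hb =>
    intro f hf i hi
    rw [_root_.map_add, add_smul, HahnSeries.coeff_add, ha f hf i hi, hb f hf i hi, add_zero]
  | neg a _ ha =>
    intro f hf i hi
    rw [_root_.map_neg, neg_smul, HahnSeries.coeff_neg, ha f hf i hi, neg_zero]
  | mul a b _ _ ha hb =>
    intro f hf i hi
    rw [_root_.map_mul, mul_smul]
    exact ha _ (hb f hf) i hi

theorem exists_coeff_eq_zero_of_lt (f : LaurentInf K) : ∃ N : ℤ, ∀ i < N, f.coeff i = 0 :=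
  ⟨f.order, fun _ hi => HahnSeries.coeff_eq_zero_of_lt_order hi⟩

/-- A `K[σ]`-linear map from a finitely generated module to `K((1/t))` has bounded image. -/
theorem exists_bound {M : ModuleCat.{u} (TSRing k K)} [hM : Module.Finite (SkewRing k K) (overSkew M)]
    (δ : overSkew M →ₗ[SkewRing k K] overSkew (ModuleCat.of (TSRing k K) (LaurentInf K))) :
    ∃ N : ℤ, ∀ m : overSkew M, ∀ i < N, HahnSeries.coeff (show LaurentInf K from δ m) i = 0 := by
  obtain ⟨S, hS⟩ := hM.fg_top
  choose b hb using exists_coeff_eq_zero_of_lt (K := K)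
  -- A common bound for the finitely many generators is a bound everywhere, as the series vanishing
  -- below $N$ form a $K[\sigma]$-submodule.
  obtain ⟨N, hN⟩ := (S.image fun m => b (show LaurentInf K from δ m)).finite_toSet.bddBelow
  refine ⟨N, fun m => ?_⟩
  have hm : m ∈ Submodule.span (SkewRing k K) (S : Set (overSkew M)) :=
    hS ▸ Submodule.mem_top
  induction hm using Submodule.span_induction with
  | mem m hm =>
    intro i hi
    exact hb _ i (hi.trans_le (hN (by
      simpa using ⟨m, hm, rfl⟩)))
  | zero =>
    intro i hi
    exact congrArg (fun g : LaurentInf K => g.coeff i) δ.map_zero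
  | add m n _ _ hm hn =>
    intro i hi
    refine (congrArg (fun g : LaurentInf K => g.coeff i) (δ.map_add m n)).trans ?_
    refine HahnSeries.coeff_add.trans ?_
    rw [hm i hi, hn i hi, add_zero]
  | smul a m _ hm =>
    intro i hi
    exact (congrArg (fun g : LaurentInf K => g.coeff i) (δ.map_smul a m)).trans
      (coeff_smul_eq_zero N a _ hm i hi)

/-- For a `K[σ]`-linear map `δ : M → K((1/t))` with `M` finitely generated over `K[σ]`, the series
`-∑ t⁻ⁿ⁻¹ δ(tⁿ m)` defines a `K[σ]`-linear map `g` with `g t - t g = δ`. -/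
theorem exists_commutator_eq {M : ModuleCat.{u} (TSRing k K)}
    [Module.Finite (SkewRing k K) (overSkew M)]
    (δ : overSkew M →ₗ[SkewRing k K] overSkew (ModuleCat.of (TSRing k K) (LaurentInf K))) :
    ∃ g : M →+ LaurentInf K,
      (∀ (x : K) (m : M), g (ofConst k K x • m) = ofConst k K x • g m) ∧
      (∀ m : M, g (σElt k K • m) = σElt k K • g m) ∧
      (∀ m : M, g (tElt k K • m) = tElt k K • g m + (show LaurentInf K from δ m)) := by
  obtain ⟨N, hN⟩ := exists_bound δ
  let D : M → LaurentInf K := fun m => δ m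
  have hDadd (m n : M) : D (m + n) = D m + D n := δ.map_add m n
  have hDc (x : K) (m : M) : D (ofConst k K x • m) = ofConst k K x • D m :=
    δ.map_smul (SkewRing.C k x) m
  have hDσ (m : M) : D (σElt k K • m) = σElt k K • D m := δ.map_smul (SkewRing.σ k K) m
  -- The coefficient at index $i$ of $t^{-j-1}\delta(t^j m)$ is that of $\delta(t^j m)$ at $i-1-j$.
  -- It vanishes as soon as $i-1-j<N$, so only the terms with $j<i-N$ remain and the sum is finite.
  let c : M → ℤ → K := fun m i =>
    -∑ j ∈ Finset.range (i - N).toNat, (D ((tElt k K) ^ j • m)).coeff (i - 1 - j)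
  have hc (m : M) : ∀ i < N, c m i = 0 := fun i hi => by
    simp only [c]
    rw [Int.toNat_of_nonpos (by omega)]
    simp
  let g : M → LaurentInf K := fun m => laurentOfCoeff (c m) N (hc m)
  have hg (m : M) (i : ℤ) : (g m).coeff i = c m i := rfl
  have hadd (m n : M) : g (m + n) = g m + g n := by
    ext i
    rw [HahnSeries.coeff_add, hg, hg, hg]
    simp only [c, smul_add, hDadd, HahnSeries.coeff_add, Finset.sum_add_distrib, neg_add]
  refine ⟨AddMonoidHom.mk' g hadd, fun x m => ?_, fun m => ?_, fun m => ?_⟩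
  · change g _ = _ • g m
    ext i
    rw [laurent_const_coeff, hg, hg]
    simp only [c]
    rw [mul_neg, Finset.mul_sum]
    refine congrArg _ (Finset.sum_congr rfl fun j _ => ?_)
    rw [← mul_smul, tElt_pow_comm_const, mul_smul, hDc, laurent_const_coeff]
  · change g _ = _ • g m
    ext i
    rw [laurent_σ_coeff, hg, hg]
    simp only [c]
    rw [← frob_apply, _root_.map_neg, _root_.map_sum]
    refine congrArg _ (Finset.sum_congr rfl fun j _ => ?_)
    rw [← mul_smul, tElt_pow_comm_σ, mul_smul, hDσ, laurent_σ_coeff, frob_apply]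
  · change g _ = _ • g m + D m
    ext i
    rw [HahnSeries.coeff_add, laurent_t_coeff, hg, hg]
    change _ = _ + HahnSeries.coeff (show LaurentInf K from δ m) i
    by_cases hi : i < N
    · rw [hc _ i hi, hN m i hi]
      simp only [c]
      rw [Int.toNat_of_nonpos (by omega)]
      simp
    · simp only [c]
      -- For $i=N+n$ the sum for $t\,g(m)$ has $n+1$ terms. Its term $j=0$ cancels $\delta(m)$, and
      -- the others, shifted by one, are the $n$ terms of $g(tm)$.
      obtain ⟨n, hn⟩ := Int.eq_ofNat_of_zero_le (sub_nonneg.2 (not_lt.1 hi))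
      rw [show (i + 1 - N).toNat = n + 1 by omega, show (i - N).toNat = n by omega,
        Finset.sum_range_succ', neg_add, add_assoc]
      have h0 : (D ((tElt k K) ^ 0 • m)).coeff (i + 1 - 1 - (0 : ℕ)) =
          HahnSeries.coeff (show LaurentInf K from δ m) i := by
        rw [pow_zero, one_smul]
        simp [D]
      rw [h0, neg_add_cancel, add_zero]
      refine congrArg _ (Finset.sum_congr rfl fun j _ => ?_)
      rw [← mul_smul, ← pow_succ]
      congr 1
      push_cast
      ring

/-- Over `K[t,σ]`, homomorphisms from a module that is free and finitely generated over `K[σ]` lift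
along surjections with kernel `K((1/t))`. -/
theorem exists_lift {M E Q : ModuleCat.{u} (TSRing k K)}
    [Module.Finite (SkewRing k K) (overSkew M)] [Module.Projective (SkewRing k K) (overSkew M)]
    (i : ModuleCat.of (TSRing k K) (LaurentInf K) ⟶ E) (p : E ⟶ Q)
    (hi : Function.Injective i.hom) (hip : Function.Exact i.hom p.hom)
    (hp : Function.Surjective p.hom) (φ : M ⟶ Q) : ∃ ψ : M ⟶ E, ψ ≫ p = φ := by
  -- This lift is only $K[\sigma]$-linear. Its defect `D` below, defined by $i\circ D=t\psi-\psi t$,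
  -- is again $K[\sigma]$-linear since $t$ commutes with $K[\sigma]$ and $i$ is injective.
  obtain ⟨ψ, hψ⟩ := Module.projective_lifting_property
    ((ModuleCat.restrictScalars (ofSkew k K).toRingHom).map p).hom
    ((ModuleCat.restrictScalars (ofSkew k K).toRingHom).map φ).hom hp
  let Ψ : M → E := fun m => ψ m
  have hΨ (m : M) : p.hom (Ψ m) = φ.hom m := LinearMap.congr_fun hψ m
  have hΨadd (m n : M) : Ψ (m + n) = Ψ m + Ψ n := ψ.map_add m n
  have hΨa (a : SkewRing k K) (m : M) : Ψ (ofSkew k K a • m) = ofSkew k K a • Ψ m :=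
    ψ.map_smul a m
  have hex (m : M) : ∃ v, i.hom v = tElt k K • Ψ m - Ψ (tElt k K • m) :=
    (hip _).1 (by rw [map_sub, map_smul, hΨ, hΨ, map_smul, sub_self])
  choose D hD using hex
  have hDadd (m n : M) : D (m + n) = D m + D n := hi (by
    rw [map_add, hD, hD, hD, smul_add, hΨadd, hΨadd, smul_add]
    abel)
  have hDa (a : SkewRing k K) (m : M) : D (ofSkew k K a • m) = ofSkew k K a • D m := hi (by
    rw [map_smul, hD, hD, hΨa, ← mul_smul, ← mul_smul, (tElt_comm k K a).eq, mul_smul, mul_smul,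
      hΨa, smul_sub])
  obtain ⟨g, hgc, hgσ, hgt⟩ := exists_commutator_eq (M := M)
    { toFun := D
      map_add' := hDadd
      map_smul' := hDa }
  have hgt' (m : M) : g (tElt k K • m) = tElt k K • g m + D m := hgt m
  -- Adding $i\circ g$ does not change the composite with $p$, and $gt-tg=D$ cancels the defect.
  let F : M →+ E := AddMonoidHom.mk' Ψ hΨadd + i.hom.toAddMonoidHom.comp g
  have hF (m : M) : F m = Ψ m + i.hom (g m) := rfl
  refine ⟨ModuleCat.ofHom (mkLinear F (fun x m => ?_) (fun m => ?_) (fun m => ?_)), ?_⟩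
  · rw [hF, hF, hgc, map_smul, smul_add]
    exact congrArg (· + _) (hΨa (SkewRing.C k x) m)
  · rw [hF, hF, hgt', map_add, map_smul, hD, smul_add]
    abel
  · rw [hF, hF, hgσ, map_smul, smul_add]
    exact congrArg (· + _) (hΨa (SkewRing.σ k K) m)
  · ext m
    change p.hom (Ψ m + i.hom (g m)) = φ.hom m
    rw [map_add, hΨ, hip.apply_apply_eq_zero, add_zero]

/-- `Hom(M, K((1/t))) = 0` if `M` is finitely generated over `K[σ]`. -/
theorem hom_laurent_eq_zero {M : ModuleCat.{u} (TSRing k K)}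
    [Module.Finite (SkewRing k K) (overSkew M)]
    (f : M ⟶ ModuleCat.of (TSRing k K) (LaurentInf K)) : f = 0 := by
  obtain ⟨N, hN⟩ := exists_bound ((ModuleCat.restrictScalars (ofSkew k K).toRingHom).map f).hom
  ext m i
  -- The coefficient of $f(m)$ at $i$ is that of $f(t^n m)$ at $i-n$; this $n$ is the least natural
  -- number with $i-n<N$.
  have h := hN ((tElt k K) ^ (i - N + 1).toNat • m : M) (i - (i - N + 1).toNat) (by omega)
  have h' : HahnSeries.coeff (f.hom ((tElt k K) ^ (i - N + 1).toNat • m))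
      (i - (i - N + 1).toNat) = 0 := h
  rw [f.hom.map_smul] at h'
  have h'' := (laurent_t_pow_coeff (i - N + 1).toNat (f.hom m) _).symm.trans h'
  rw [sub_add_cancel] at h''
  exact h''

/-- `Ext¹(M, K((1/t))) = 0` if `M` is finitely generated and projective over `K[σ]`. -/
theorem ext_laurent_eq_zero {M : ModuleCat.{u} (TSRing k K)}
    [Module.Finite (SkewRing k K) (overSkew M)] [Module.Projective (SkewRing k K) (overSkew M)]
    (e : Abelian.Ext.{u} M (ModuleCat.of (TSRing k K) (LaurentInf K)) 1) : e = 0 := by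
  -- Embedding $K((1/t))$ in an injective module $I$ turns a class in $\operatorname{Ext}^1$ into a
  -- homomorphism $M\to I/K((1/t))$. The class vanishes if this homomorphism lifts to $I$, which is
  -- the situation of `exists_lift`.
  let S : ShortComplex (ModuleCat.{u} (TSRing k K)) :=
    ShortComplex.mk (Injective.ι (ModuleCat.of (TSRing k K) (LaurentInf K)))
      (Limits.cokernel.π (Injective.ι (ModuleCat.of (TSRing k K) (LaurentInf K))))
      (Limits.cokernel.condition _)
  have hS : S.ShortExact :=
    { exact := ShortComplex.exact_cokernel _
      mono_f := inferInstanceAs (Mono (Injective.ι _))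
      epi_g := inferInstanceAs (Epi (Limits.cokernel.π _)) }
  obtain ⟨x, hx⟩ := Abelian.Ext.covariant_sequence_exact₁ M hS e
    (Abelian.Ext.eq_zero_of_injective (n := 0) (I := Injective.under _) _) (zero_add 1)
  obtain ⟨φ, rfl⟩ := (Abelian.Ext.mk₀_bijective M S.X₃).2 x
  obtain ⟨ψ, rfl⟩ := exists_lift S.f S.g hS.moduleCat_injective_f
    ((ShortComplex.ShortExact.moduleCat_exact_iff_function_exact S).1 hS.exact)
    hS.moduleCat_surjective_g φ
  rw [← hx, ← Abelian.Ext.mk₀_comp_mk₀, Abelian.Ext.comp_assoc_of_second_deg_zero, hS.comp_extClass,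
    Abelian.Ext.comp_zero]

/-! ### The connecting isomorphism, the map $\Phi$ and its naturality in $M$. -/

theorem connecting_add {M : ModuleCat.{u} (TSRing k K)}
    (ξ η : M ⟶ ModuleCat.of (TSRing k K) (PolarParts k K)) :
    connecting (ξ + η) = connecting ξ + connecting η :=
  (congrArg (fun e : Abelian.Ext.{u} M (polarSeq k K).X₃ 0 =>
    e.comp (polarSeq_shortExact k K).extClass (zero_add 1)) (Abelian.Ext.mk₀_add ξ η)).trans
    (Abelian.Ext.add_comp _ _ _ _)

theorem connecting_smul {M : ModuleCat.{u} (TSRing k K)} (p : k[X])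
    (ξ : M ⟶ ModuleCat.of (TSRing k K) (PolarParts k K)) :
    connecting (p • ξ) = p • connecting ξ :=
  (congrArg (fun e : Abelian.Ext.{u} M (polarSeq k K).X₃ 0 =>
    e.comp (polarSeq_shortExact k K).extClass (zero_add 1)) (Abelian.Ext.mk₀_smul p ξ)).trans
    (Abelian.Ext.smul_comp _ _ _ _)

/-- The connecting map as a `k[t]`-linear map. -/
def connectingLinear (M : ModuleCat.{u} (TSRing k K)) :
    (M ⟶ ModuleCat.of (TSRing k K) (PolarParts k K)) →ₗ[k[X]] ExtUnit M where
  toFun := connecting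
  map_add' := connecting_add
  map_smul' := connecting_smul

/-- The kernel of $\partial$ is the image of $\operatorname{Hom}(M,K((1/t)))=0$. -/
theorem connecting_injective {M : ModuleCat.{u} (TSRing k K)}
    [Module.Finite (SkewRing k K) (overSkew M)] :
    Function.Injective
      (connecting : (M ⟶ ModuleCat.of (TSRing k K) (PolarParts k K)) → ExtUnit M) := by
  refine (injective_iff_map_eq_zero (connectingLinear M)).2 fun ξ hξ => ?_
  obtain ⟨x, hx⟩ := Abelian.Ext.covariant_sequence_exact₃ M (polarSeq_shortExact k K)
    (Abelian.Ext.mk₀ ξ) (zero_add 1) hξ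
  obtain ⟨φ, rfl⟩ := (Abelian.Ext.mk₀_bijective M _).2 x
  have hφ : φ = 0 := hom_laurent_eq_zero φ
  rw [hφ, Abelian.Ext.mk₀_zero, Abelian.Ext.zero_comp] at hx
  exact (Abelian.Ext.mk₀_eq_zero_iff ξ).1 hx.symm

/-- The obstruction to lying in the image of $\partial$ is the image in
$\operatorname{Ext}^1(M,K((1/t)))=0$. -/
theorem connecting_surjective {M : ModuleCat.{u} (TSRing k K)}
    [Module.Finite (SkewRing k K) (overSkew M)] [Module.Projective (SkewRing k K) (overSkew M)] :
    Function.Surjective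
      (connecting : (M ⟶ ModuleCat.of (TSRing k K) (PolarParts k K)) → ExtUnit M) := by
  intro e
  obtain ⟨x, hx⟩ := Abelian.Ext.covariant_sequence_exact₁ M (polarSeq_shortExact k K) e
    (ext_laurent_eq_zero _) (zero_add 1)
  obtain ⟨φ, rfl⟩ := (Abelian.Ext.mk₀_bijective M _).2 x
  exact ⟨φ, hx⟩

/-- Composition with the residue map, as a `k[t]`-linear map. -/
def resLinear (M : ModuleCat.{u} (TSRing k K)) :
    (M ⟶ ModuleCat.of (TSRing k K) (PolarParts k K)) →ₗ[k[X]] HomSkew M where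
  toFun := HomSkew.resMap
  map_add' ξ η := by
    ext m
    exact (res k K).map_add (ξ.hom m) (η.hom m)
  map_smul' p ξ := by
    ext m
    exact congrArg (res k K) (ξ.hom.map_smul (p ⊗ₜ[k] (1 : SkewRing k K) : TSRing k K) m).symm

/-- The residue isomorphism `Hom(M, K((1/t))/K[t]) ≃ Hom(M, K)`. -/
def resEquiv (M : ModuleCat.{u} (TSRing k K)) :
    (M ⟶ ModuleCat.of (TSRing k K) (PolarParts k K)) ≃ₗ[k[X]] HomSkew M :=
  LinearEquiv.ofBijective (resLinear M) ⟨HomSkew.resMap_injective, HomSkew.resMap_surjective⟩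

theorem resEquiv_apply {M : ModuleCat.{u} (TSRing k K)}
    (ξ : M ⟶ ModuleCat.of (TSRing k K) (PolarParts k K)) : resEquiv M ξ = HomSkew.resMap ξ := rfl

/-- The connecting isomorphism `Hom(M, K((1/t))/K[t]) ≃ Ext¹(M, K[t])`. -/
def connectingEquiv {M : ModuleCat.{u} (TSRing k K)} (hM : IsFreeFinite M) :
    (M ⟶ ModuleCat.of (TSRing k K) (PolarParts k K)) ≃ₗ[k[X]] ExtUnit M :=
  haveI : Module.Finite (SkewRing k K) (overSkew M) := hM.finite_skew
  haveI : Module.Free (SkewRing k K) (overSkew M) := hM.free_skew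
  LinearEquiv.ofBijective (connectingLinear M) ⟨connecting_injective, connecting_surjective⟩

/-- The isomorphism `Hom(M, K) ≃ Ext¹(M, K[t])`. -/
def homSkewEquivExt {M : ModuleCat.{u} (TSRing k K)} (hM : IsFreeFinite M) :
    HomSkew M ≃ₗ[k[X]] ExtUnit M :=
  (resEquiv M).symm.trans (connectingEquiv hM)

theorem homSkewEquivExt_resMap {M : ModuleCat.{u} (TSRing k K)} (hM : IsFreeFinite M)
    (ξ : M ⟶ ModuleCat.of (TSRing k K) (PolarParts k K)) :
    homSkewEquivExt hM (HomSkew.resMap ξ) = connecting ξ := by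
  rw [← resEquiv_apply, homSkewEquivExt, LinearEquiv.trans_apply, LinearEquiv.symm_apply_apply]
  rfl

/-- With $\nu=\operatorname{Res}\circ\xi$, both sides are the Yoneda product of $f$, $\xi$ and the
class of the polar sequence. -/
theorem homSkewEquivExt_precomp {M N : ModuleCat.{u} (TSRing k K)} (hM : IsFreeFinite M)
    (hN : IsFreeFinite N) (f : M ⟶ N) (ν : HomSkew N) :
    homSkewEquivExt hM (HomSkew.precomp f ν) =
      (Abelian.Ext.mk₀ f).comp (homSkewEquivExt hN ν) (zero_add 1) := by
  obtain ⟨ξ, rfl⟩ := HomSkew.resMap_surjective ν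
  have h : HomSkew.precomp f (HomSkew.resMap ξ) = HomSkew.resMap (f ≫ ξ) := rfl
  rw [h, homSkewEquivExt_resMap, homSkewEquivExt_resMap]
  exact (Abelian.Ext.mk₀_comp_mk₀_assoc (Z := (polarSeq k K).X₃) f ξ _).symm

end Splitting

/-! ### Compatibility of residues and connecting maps with field extensions. -/

section BaseChangeCompat

variable {k K : Type u} [Field k] [Finite k] [Field K] [Algebra k K]
variable (K' : Type u) [Field K'] [Algebra k K'] [Algebra K K'] [IsScalarTower k K K']

/-- The map `K((1/t)) → K'((1/t))` as a `K`-linear map. -/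
def laurentBaseChangeAux (k K K' : Type u) [Field k] [Finite k] [Field K] [Algebra k K] [Field K']
    [Algebra k K'] [Algebra K K'] [IsScalarTower k K K'] :
    overField (ModuleCat.of (TSRing k K) (LaurentInf K)) →ₗ[K] LaurentInf K' where
  toFun f := HahnSeries.map (show LaurentInf K from f) (algebraMap K K')
  map_add' f g := by
    ext i
    exact (algebraMap K K').map_add _ _
  map_smul' x f := by
    ext i
    refine (congrArg (algebraMap K K') (laurent_const_coeff x (show LaurentInf K from f) i)).trans ?_
    rw [_root_.map_mul, RingHom.id_apply, HahnSeries.coeff_smul, Algebra.smul_def]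
    rfl

/-- The map `x ⊗ f ↦ x f` from the base change of `K((1/t))` to `K'((1/t))`. -/
def laurentBaseChangeLin (k K K' : Type u) [Field k] [Finite k] [Field K] [Algebra k K] [Field K']
    [Algebra k K'] [Algebra K K'] [IsScalarTower k K K'] :
    K' ⊗[K] overField (ModuleCat.of (TSRing k K) (LaurentInf K)) →ₗ[K'] LaurentInf K' :=
  (laurentBaseChangeAux k K K').liftBaseChange K'

theorem laurentBaseChangeLin_tmul_coeff (x : K')
    (f : overField (ModuleCat.of (TSRing k K) (LaurentInf K))) (i : ℤ) :
    (laurentBaseChangeLin k K K' (x ⊗ₜ f)).coeff i =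
      x * algebraMap K K' ((show LaurentInf K from f).coeff i) := rfl

/-- The homomorphism `x ⊗ f ↦ x f` from the base change of `K((1/t))` to `K'((1/t))`. -/
def laurentBaseChange (k K K' : Type u) [Field k] [Finite k] [Field K] [Algebra k K] [Field K']
    [Algebra k K'] [Algebra K K'] [IsScalarTower k K K'] :
    (baseChange k K K').obj (ModuleCat.of (TSRing k K) (LaurentInf K)) ⟶
      ModuleCat.of (TSRing k K') (LaurentInf K') :=
  ModuleCat.ofHom (X := K' ⊗[K] overField (ModuleCat.of (TSRing k K) (LaurentInf K))) (mkLinear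
    (laurentBaseChangeLin k K K').toAddMonoidHom
    (fun x z => by
      rw [baseChange_const_smul]
      refine Eq.trans ?_ (tsModule_const (k := k) _ _ _ x _).symm
      exact map_smul (laurentBaseChangeLin k K K') x z)
    (fun z => by
      rw [baseChange_t_smul]
      change laurentBaseChangeLin k K K' _ = _ • laurentBaseChangeLin k K K' z
      ext i
      rw [laurent_t_coeff]
      induction z using TensorProduct.induction_on with
      | zero => simp
      | add z w hz hw =>
        rw [_root_.map_add, _root_.map_add, _root_.map_add, HahnSeries.coeff_add,
          HahnSeries.coeff_add, hz, hw]
      | tmul y f =>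
        rw [LinearMap.baseChange_tmul, laurentBaseChangeLin_tmul_coeff,
          laurentBaseChangeLin_tmul_coeff]
        exact congrArg (fun a => y * algebraMap K K' a) (laurent_t_coeff (k := k) _ i))
    (fun z => by
      rw [baseChange_σ_smul]
      change laurentBaseChangeLin k K K' _ = _ • laurentBaseChangeLin k K K' z
      ext i
      rw [laurent_σ_coeff, ← frob_apply]
      induction z using TensorProduct.induction_on with
      | zero => simp
      | add z w hz hw =>
        rw [_root_.map_add, _root_.map_add, _root_.map_add, HahnSeries.coeff_add,
          HahnSeries.coeff_add, _root_.map_add, hz, hw]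
      | tmul y f =>
        rw [σBaseChange_tmul, laurentBaseChangeLin_tmul_coeff, laurentBaseChangeLin_tmul_coeff,
          frob_apply, mul_pow, ← _root_.map_pow]
        exact congrArg (fun a => y ^ Nat.card k * algebraMap K K' a)
          (laurent_σ_coeff (k := k) _ i)))

theorem baseChange_hom_ext {M : ModuleCat.{u} (TSRing k K)} {N : ModuleCat.{u} (TSRing k K')}
    {f g : (baseChange k K K').obj M ⟶ N}
    (h : ∀ (x : K') (m : overField M), f.hom (x ⊗ₜ[K] m : K' ⊗[K] overField M) =
      g.hom (x ⊗ₜ[K] m : K' ⊗[K] overField M)) : f = g := by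
  ext z
  change K' ⊗[K] overField M at z
  induction z using TensorProduct.induction_on with
  | zero => exact f.hom.map_zero.trans g.hom.map_zero.symm
  | add z w hz hw =>
    exact (f.hom.map_add z w).trans ((congrArg₂ (· + ·) hz hw).trans (g.hom.map_add z w).symm)
  | tmul x m => exact h x m

/-- This is the left square of the morphism of polar sequences; no invertibility of the map on
Laurent series is needed. -/
theorem polarSeq_baseChange_comm :
    unitBaseChange k K K' ≫ (polarSeq k K').f =
      (baseChange k K K').map (polarSeq k K).f ≫ laurentBaseChange k K K' := by
  refine baseChange_hom_ext K' fun x p => ?_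
  refine HahnSeries.ext (funext fun i => ?_)
  change (polyToLaurentRing K' (x • Polynomial.map (algebraMap K K') (show K[X] from p))).coeff i =
    x * algebraMap K K' ((polyToLaurentRing K (show K[X] from p)).coeff i)
  rw [polyToLaurentRing_coeff, polyToLaurentRing_coeff]
  split_ifs
  · rw [coeff_smul, smul_eq_mul]
    exact congrArg _ (coeff_map _ _)
  · rw [_root_.map_zero, mul_zero]

theorem baseChange_polarSeq_comp :
    ((polarSeq k K).map (baseChange k K K')).f ≫
      (show ((polarSeq k K).map (baseChange k K K')).X₂ ⟶ (polarSeq k K').X₃ from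
        laurentBaseChange k K K' ≫ (polarSeq k K').g) = 0 := by
  have h : (baseChange k K K').map (polarSeq k K).f ≫ laurentBaseChange k K K' ≫
      (polarSeq k K').g = unitBaseChange k K K' ≫ (polarSeq k K').f ≫ (polarSeq k K').g := by
    have := congrArg (· ≫ (polarSeq k K').g) (polarSeq_baseChange_comm (k := k) (K := K) K')
    exact this.symm
  exact h.trans ((congrArg (unitBaseChange k K K' ≫ ·) (polarSeq k K').zero).trans
    Limits.comp_zero)

/-- The morphism from the base change of `K[t] → K((1/t)) → K((1/t))/K[t]` to the same sequence
over `K'`. -/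
def polarSeqBaseChange :
    (polarSeq k K).map (baseChange k K K') ⟶ polarSeq k K' where
  τ₁ := unitBaseChange k K K'
  τ₂ := laurentBaseChange k K K'
  -- The tensored sequence is still exact, so its third term is a cokernel and the map on it is
  -- forced by the one on Laurent series.
  τ₃ :=
    haveI := (baseChange_shortExact K' _ (polarSeq_shortExact k K)).epi_g
    (baseChange_shortExact K' _ (polarSeq_shortExact k K)).exact.desc
      (laurentBaseChange k K K' ≫ (polarSeq k K').g) (baseChange_polarSeq_comp K')
  comm₁₂ := polarSeq_baseChange_comm K'
  comm₂₃ := by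
    have := (baseChange_shortExact K' _ (polarSeq_shortExact k K)).epi_g
    exact ((baseChange_shortExact K' _ (polarSeq_shortExact k K)).exact.g_desc _ _).symm

/-- An exact functor respects Yoneda products and extension classes. Naturality of the class along
`polarSeqBaseChange` then trades `τ₁` after the class for `τ₃` before it. -/
theorem extBaseChange_connecting {M : ModuleCat.{u} (TSRing k K)}
    (ξ : M ⟶ ModuleCat.of (TSRing k K) (PolarParts k K)) :
    extBaseChange K' (connecting ξ) =
      connecting ((baseChange k K K').map ξ ≫ (polarSeqBaseChange K').τ₃) := by
  have h1 : (connecting ξ).mapExactFunctor (baseChange k K K') =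
      (Abelian.Ext.mk₀ ((baseChange k K K').map ξ)).comp
        ((polarSeq_shortExact k K).map_of_exact (baseChange k K K')).extClass (zero_add 1) :=
    (Abelian.Ext.mapExactFunctor_comp _ (Abelian.Ext.mk₀ (Y := (polarSeq k K).X₃) ξ)
      (polarSeq_shortExact k K).extClass (zero_add 1)).trans
      (congrArg₂ (fun a b => Abelian.Ext.comp a b (zero_add 1))
        (Abelian.Ext.mapExactFunctor_mk₀ _ _) (Abelian.Ext.mapExactFunctor_extClass _ _))
  rw [extBaseChange, h1]
  refine (Abelian.Ext.comp_assoc_of_third_deg_zero _ _ _ _).trans ?_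
  refine (congrArg (fun e => Abelian.Ext.comp (Abelian.Ext.mk₀ ((baseChange k K K').map ξ)) e
    (zero_add 1)) (((polarSeq_shortExact k K).map_of_exact
      (baseChange k K K')).extClass_naturality (polarSeq_shortExact k K')
      (polarSeqBaseChange K'))).trans ?_
  exact Abelian.Ext.mk₀_comp_mk₀_assoc _ _ _

theorem resMap_baseChange {M : ModuleCat.{u} (TSRing k K)}
    (ξ : M ⟶ ModuleCat.of (TSRing k K) (PolarParts k K)) :
    HomSkew.resMap ((baseChange k K K').map ξ ≫ (polarSeqBaseChange K').τ₃) =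
      HomSkew.baseChange K' (HomSkew.resMap ξ) := by
  ext z
  change K' ⊗[K] overField M at z
  induction z using TensorProduct.induction_on with
  | zero => exact (HomSkew.toLin _).map_zero.trans (HomSkew.toLin _).map_zero.symm
  | add z w hz hw =>
    exact (HomSkew.map_add _ _ _).trans
      ((congrArg₂ (· + ·) hz hw).trans (HomSkew.map_add _ _ _).symm)
  | tmul y m =>
    rw [HomSkew.baseChange_tmul, HomSkew.resMap_apply]
    -- The map `τ₃` is known only through its composite with the projection, so the principal part
    -- is represented by a Laurent series, where the residue is a coefficient.
    obtain ⟨f, hf⟩ := Submodule.mkQ_surjective _ (ξ.hom (show M from m))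
    have h1 : (polarSeqBaseChange (k := k) (K := K) K').τ₃.hom
        (y ⊗ₜ[K] (LinearMap.range (polyToLaurent k K)).mkQ f :
          K' ⊗[K] overField (ModuleCat.of (TSRing k K) (PolarParts k K))) =
        (LinearMap.range (polyToLaurent k K')).mkQ ((laurentBaseChange k K K').hom
          (y ⊗ₜ[K] f : K' ⊗[K] overField (ModuleCat.of (TSRing k K) (LaurentInf K)))) :=
      (congrArg (fun φ => φ.hom
        (y ⊗ₜ[K] f : K' ⊗[K] overField (ModuleCat.of (TSRing k K) (LaurentInf K))))
        (polarSeqBaseChange (k := k) (K := K) K').comm₂₃).symm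
    have h2 : res k K' ((polarSeqBaseChange (k := k) (K := K) K').τ₃.hom
        (y ⊗ₜ[K] (LinearMap.range (polyToLaurent k K)).mkQ f :
          K' ⊗[K] overField (ModuleCat.of (TSRing k K) (PolarParts k K)))) =
        y * algebraMap K K' (res k K ((LinearMap.range (polyToLaurent k K)).mkQ f)) :=
      congrArg (res k K') h1
    rw [hf] at h2
    exact h2

end BaseChangeCompat

/-! ### Freeness and finiteness under field extension. -/

section FreeBaseChange

/-- If the products of a basis of `A` over `F` with a finite family `v` in `N` form a basis of `N`
over `F`, then `N` is a free `A`-module of finite rank. -/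
theorem free_and_finite_of_basis {F A N ι κ : Type*} [Finite κ] [Ring F] [Ring A] [Module F A]
    [AddCommGroup N] [Module A N] [Module F N] [IsScalarTower F A N] (a : Module.Basis ι F A)
    (v : κ → N) (b : Module.Basis (ι × κ) F N) (h : ∀ i j, b (i, j) = a i • v j) :
    Module.Free A N ∧ Module.Finite A N := by
  let L : (κ →₀ A) →ₗ[A] N := Finsupp.linearCombination A v
  let e : (κ →₀ A) ≃ₗ[F] N := (Finsupp.basis fun _ : κ => a).equiv b
    ((Equiv.sigmaEquivProd κ ι).trans (Equiv.prodComm κ ι))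
  let L' : (κ →₀ A) →ₗ[F] N :=
    { toFun := L
      map_add' := L.map_add
      map_smul' := fun x f => by
        induction f using Finsupp.induction_linear with
        | zero => simp
        | add f g hf hg => rw [smul_add, map_add, hf, hg, map_add, smul_add]
        | single j y => simp [L, smul_assoc] }
  -- The $A$-linear map given by `v` carries the product basis of $A^{(\kappa)}$ over $F$ to the
  -- basis `b`, so it is bijective.
  have hLe : L' = e.toLinearMap := by
    refine (Finsupp.basis fun _ : κ => a).ext fun ji => ?_
    rw [LinearEquiv.coe_coe, Module.Basis.equiv_apply]
    refine Eq.trans ?_ (h ji.2 ji.1).symm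
    change Finsupp.linearCombination A v _ = _
    simp
  have hbij : Function.Bijective L := by
    have : (L : (κ →₀ A) → N) = e := funext fun f => LinearMap.congr_fun hLe f
    rw [this]
    exact e.bijective
  exact ⟨Module.Free.of_equiv (LinearEquiv.ofBijective L hbij),
    Module.Finite.equiv (LinearEquiv.ofBijective L hbij)⟩

variable {k K : Type u} [Field k] [Finite k] [Field K] [Algebra k K]
variable (K' : Type u) [Field K'] [Algebra k K'] [Algebra K K'] [IsScalarTower k K K']

/-- Base change preserves being free of finite rank over a subring generated freely by one
element as a left module over the constants. -/
theorem free_and_finite_baseChange {A A' : Type u} [Ring A] [Ring A'] (ρ : A →+* TSRing k K)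
    (ρ' : A' →+* TSRing k K') [Module K A] [Module K' A'] (c : K →+* A) (c' : K' →+* A')
    (hc : ∀ x, ρ (c x) = ofConst k K x) (hc' : ∀ x, ρ' (c' x) = ofConst k K' x)
    (hsmul : ∀ (x : K) (y : A), x • y = c x * y) (hsmul' : ∀ (x : K') (y : A'), x • y = c' x * y)
    (s : A) (s' : A') (a : Module.Basis ℕ K A) (a' : Module.Basis ℕ K' A')
    (ha : ∀ n, a n = s ^ n) (ha' : ∀ n, a' n = s' ^ n) (M : ModuleCat.{u} (TSRing k K))
    (hs : ∀ m : M, ρ' s' • ((1 : K') ⊗ₜ[K] (show overField M from m) : K' ⊗[K] overField M) =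
      (1 : K') ⊗ₜ[K] (show overField M from ρ s • m))
    (hfree : Module.Free A ((ModuleCat.restrictScalars ρ).obj M))
    (hfin : Module.Finite A ((ModuleCat.restrictScalars ρ).obj M)) :
    Module.Free A' ((ModuleCat.restrictScalars ρ').obj ((baseChange k K K').obj M)) ∧
      Module.Finite A' ((ModuleCat.restrictScalars ρ').obj ((baseChange k K K').obj M)) := by
  have hpow (n : ℕ) (m : M) :
      ρ' (s' ^ n) • ((1 : K') ⊗ₜ[K] (show overField M from m) : K' ⊗[K] overField M) =
        (1 : K') ⊗ₜ[K] (show overField M from ρ (s ^ n) • m) := by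
    induction n with
    | zero =>
      rw [pow_zero, pow_zero, map_one, map_one]
      exact (one_smul (TSRing k K') _).trans
        (congrArg (fun m : overField M => (1 : K') ⊗ₜ[K] m) (one_smul (TSRing k K) m).symm)
    | succ n ih => rw [pow_succ', pow_succ', map_mul, map_mul, mul_smul, mul_smul, ih, hs]
  -- Over a zero ring a finitely generated module could have a basis with infinite index set.
  have : Nontrivial A := ⟨a 0, a 1, a.injective.ne zero_ne_one⟩
  let : Module K ((ModuleCat.restrictScalars ρ).obj M) := Module.compHom _ c
  have : IsScalarTower K A ((ModuleCat.restrictScalars ρ).obj M) :=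
    ⟨fun x y m => by rw [hsmul, mul_smul]; rfl⟩
  let : Module K' ((ModuleCat.restrictScalars ρ').obj ((baseChange k K K').obj M)) :=
    Module.compHom _ c'
  have : IsScalarTower K' A' ((ModuleCat.restrictScalars ρ').obj ((baseChange k K K').obj M)) :=
    ⟨fun x y m => by rw [hsmul', mul_smul]; rfl⟩
  let e : (ModuleCat.restrictScalars ρ).obj M ≃ₗ[K] overField M :=
    { AddEquiv.refl M with
      map_smul' := fun x m => congrArg (fun r => r • (show M from m)) (hc x) }
  let e' : (K' ⊗[K] overField M) ≃ₗ[K']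
      (ModuleCat.restrictScalars ρ').obj ((baseChange k K K').obj M) :=
    { AddEquiv.refl (K' ⊗[K] overField M) with
      map_smul' := fun x z => (baseChange_const_smul K' M x z).symm.trans
        (congrArg (fun r => r • z) (hc' x).symm) }
  let b := Module.Free.chooseBasis A ((ModuleCat.restrictScalars ρ).obj M)
  have := Module.Finite.finite_basis b
  -- The elements $s^n b_j$ form a $K$-basis of $M$, hence the $1\otimes s^n b_j=s'^n(1\otimes b_j)$
  -- form a $K'$-basis of $M_{K'}$. So the $1\otimes b_j$ are an $A'$-basis.
  let B := (((a.smulTower b).map e).baseChange K').map e'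
  refine free_and_finite_of_basis a'
    (fun j => e' ((1 : K') ⊗ₜ[K] e (b j))) B fun i j => ?_
  rw [Module.Basis.map_apply, Module.Basis.baseChange_apply, Module.Basis.map_apply,
    Module.Basis.smulTower_apply, ha, ha']
  exact (hpow i (b j)).symm

variable (k K)

/-- The `K`-vector space structure on `K[σ]` given by left multiplication by constants. -/
abbrev SkewRing.moduleConst : Module K (SkewRing k K) :=
  inferInstanceAs (Module (Tw k K) (SkewRing k K))

/-- The powers of `σ` form a `K`-basis of `K[σ]`. -/
def SkewRing.basis : letI := SkewRing.moduleConst k K; Module.Basis ℕ K (SkewRing k K) :=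
  (SkewMonoidAlgebra.basisSingleOne :
    Module.Basis (Multiplicative ℕ) (Tw k K) (SkewRing k K)).reindex Multiplicative.toAdd

theorem SkewRing.const_smul_eq (x : K) (y : SkewRing k K) :
    letI := SkewRing.moduleConst k K; x • y = SkewRing.C k x * y := by
  change (toTw k K x) • y = SkewMonoidAlgebra.single 1 (toTw k K x) * y
  induction y using SkewMonoidAlgebra.induction_on with
  | zero => simp
  | add f g hf hg => rw [smul_add, hf, hg, mul_add]
  | single g a => simp [SkewMonoidAlgebra.single_mul_single, SkewMonoidAlgebra.smul_single]

theorem SkewRing.basis_apply (n : ℕ) :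
    letI := SkewRing.moduleConst k K; SkewRing.basis k K n = SkewRing.σ k K ^ n := by
  have h := SkewRing.single_eq (k := k) n (1 : Tw k K)
  rw [_root_.map_one, _root_.map_one, one_mul] at h
  refine Eq.trans ?_ h
  change (SkewMonoidAlgebra.basisSingleOne.reindex Multiplicative.toAdd) n = _
  rw [Module.Basis.reindex_apply]
  rfl

variable {k K}

/-- The same basis argument applies to $K[t]$ with $s=t$ and to $K[\sigma]$ with $s=\sigma$; in the
second case $\sigma(1\otimes m)=1\otimes\sigma m$ because $1^q=1$. -/
theorem isFreeFinite_baseChange {M : ModuleCat.{u} (TSRing k K)} (hM : IsFreeFinite M) :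
    IsFreeFinite ((baseChange k K K').obj M) := by
  have h1 := free_and_finite_baseChange K' (ofPoly k K) (ofPoly k K') Polynomial.C Polynomial.C
    (fun x => eval₂_C _ _) (fun x => eval₂_C _ _) (fun x y => smul_eq_C_mul x)
    (fun x y => smul_eq_C_mul x) X X (basisMonomials K) (basisMonomials K')
    (fun n => by rw [coe_basisMonomials, X_pow_eq_monomial])
    (fun n => by rw [coe_basisMonomials, X_pow_eq_monomial]) M
    (fun m => by
      have h (L : Type u) [Field L] [Algebra k L] : ofPoly k L X = tElt k L := eval₂_X _ _
      rw [h, h, baseChange_t_smul, LinearMap.baseChange_tmul]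
      rfl)
    hM.free_poly hM.finite_poly
  let := SkewRing.moduleConst k K
  let := SkewRing.moduleConst k K'
  have h2 := free_and_finite_baseChange K' (ofSkew k K).toRingHom (ofSkew k K').toRingHom
    (SkewRing.C k).toRingHom (SkewRing.C k).toRingHom (fun x => rfl) (fun x => rfl)
    (SkewRing.const_smul_eq k K) (SkewRing.const_smul_eq k K') (SkewRing.σ k K) (SkewRing.σ k K')
    (SkewRing.basis k K) (SkewRing.basis k K') (SkewRing.basis_apply k K)
    (SkewRing.basis_apply k K') M
    (fun m => by
      refine (baseChange_σ_smul K' M _).trans ?_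
      rw [σBaseChange_tmul, one_pow]
      rfl)
    hM.free_skew hM.finite_skew
  exact ⟨h1.1, h1.2, h2.1, h2.2⟩

end FreeBaseChange

/-- Writing $\mu=\operatorname{Res}\circ\xi$, the same base-changed homomorphism has residue
$\mu_{K'}$ and has as its connecting class the base change of $\partial(\xi)$. -/
theorem homSkewEquivExt_baseChange {k K : Type u} [Field k] [Finite k] [Field K] [Algebra k K]
    (K' : Type u) [Field K'] [Algebra k K'] [Algebra K K'] [IsScalarTower k K K']
    {M : ModuleCat.{u} (TSRing k K)} (hM : IsFreeFinite M)
    (hM' : IsFreeFinite ((baseChange k K K').obj M)) (μ : HomSkew M) :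
    homSkewEquivExt hM' (HomSkew.baseChange K' μ) = extBaseChange K' (homSkewEquivExt hM μ) := by
  obtain ⟨ξ, rfl⟩ := HomSkew.resMap_surjective μ
  rw [homSkewEquivExt_resMap, extBaseChange_connecting, ← resMap_baseChange]
  exact homSkewEquivExt_resMap hM' _

end

end TMotif

open CategoryTheory Polynomial TMotif in
theorem theorem1 (k : Type u) [Field k] [Finite k] :
    ∃ Φ : ∀ (K : Type u) [Field K] [Algebra k K] (M : ModuleCat.{u} (TSRing k K)),
        IsFreeFinite M → (HomSkew M ≃ₗ[k[X]] ExtUnit M),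
      -- the isomorphism is the connecting map after the inverse of the residue map
      (∀ (K : Type u) [Field K] [Algebra k K] (M : ModuleCat.{u} (TSRing k K))
          (hM : IsFreeFinite M),
        Function.Bijective
          (HomSkew.resMap : (M ⟶ ModuleCat.of (TSRing k K) (PolarParts k K)) → HomSkew M) ∧
        ∀ ξ : M ⟶ ModuleCat.of (TSRing k K) (PolarParts k K),
          Φ K M hM (HomSkew.resMap ξ) = connecting ξ) ∧
      -- it is natural in the module
      (∀ (K : Type u) [Field K] [Algebra k K] (M N : ModuleCat.{u} (TSRing k K))
          (hM : IsFreeFinite M) (hN : IsFreeFinite N) (f : M ⟶ N) (ν : HomSkew N),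
        Φ K M hM (HomSkew.precomp f ν) =
          (Abelian.Ext.mk₀ f).comp (Φ K N hN ν) (zero_add 1)) ∧
      -- it is compatible with field extensions
      (∀ (K K' : Type u) [Field K] [Field K'] [Algebra k K] [Algebra k K'] [Algebra K K']
          [IsScalarTower k K K'] (M : ModuleCat.{u} (TSRing k K)) (hM : IsFreeFinite M),
        ∃ hM' : IsFreeFinite ((baseChange k K K').obj M), ∀ μ : HomSkew M,
          Φ K' ((baseChange k K K').obj M) hM' (HomSkew.baseChange K' μ) =
            extBaseChange K' (Φ K M hM μ)) :=
  ⟨fun _ _ _ _ hM => homSkewEquivExt hM,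
    fun _ _ _ _ hM => ⟨⟨HomSkew.resMap_injective, HomSkew.resMap_surjective⟩,
      fun ξ => homSkewEquivExt_resMap hM ξ⟩,
    fun _ _ _ _ _ hM hN f ν => homSkewEquivExt_precomp hM hN f ν,
    fun _ K' _ _ _ _ _ _ _ hM => ⟨isFreeFinite_baseChange K' hM,
      fun μ => homSkewEquivExt_baseChange K' hM _ μ⟩⟩
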